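/- **Setting (stochastic $\mathrm{BwK}_p$).** Fix integers $n,d,T\ge 1$, a real $p\ge 1$ and a budget $B>0$. In round $t=1,\dots,T$ an online algorithm plays a distribution $x^{(t)}\in\Delta_n$ over $n$ actions; the data $(r^{(t)},C^{(t)})\in[0,1]^{n}\times[0,1]^{d\times n}$ of the rounds are drawn i.i.d. from an unknown distribution. The algorithm receives reward $r^{(t)}x^{(t)}$, incurs cost $C^{(t)}x^{(t)}$, which it observes, and receives full or partial feedback: it learns $M(x^{(t)})r^{(t)}$ and $M(x^{(t)})v$ for every row $v$ of $C^{(t)}$, where $M$ is a fixed matrix-valued (measurable) function of the played distribution ($M(x)=I$ is full feedback, $M(x)=x^{\top}$ is bandit feedback). One action is a null action with reward $0$ and cost $0$. As soon as $\|\sum_{s\le t} C^{(s)}x^{(s)}\|_p>B$, only the null action may be played afterwards; let $\tau\le T$ be the last round before this happens including the round in which the budget is exceeded ($\tau=T$ if it is never exceeded). For $x\in\Delta_n$ let $\tau^*(x)\le T$ be maximal with $\|\mathbb E[\sum_{t\le\tau^*(x)}C^{(t)}x]\|_p\le B$, and $\mathrm{OPT}=\max_{x\in\Delta_n}\mathbb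 E[\sum_{t\le\tau^*(x)}r^{(t)}x]$. Write $L=\|\mathbf 1_d\|_p=d^{1/p}$. **Regret.** Let $\mathcal A$ be a (randomized) one-dimensional online learner on $n$ actions for rewards in $[-1,1]$ and horizon $T$, which after playing $x$ against the reward vector $R$ observes $M(x)R$, and let $\mathrm{Regret}$ be a bound on its expected regret: against every adaptive adversary and every fixed $x\in\Delta_n$, $\mathbb E[\sum_t R^{(t)}x-\sum_t R^{(t)}x^{(t)}]\le\mathrm{Regret}$. **Algorithm.** For real $r\ge1$ let $\|(x_0,y)\|_{p,r}=(|x_0|^r+\|y\|_p^r)^{1/r}$ and $\|(x_0,y)\|_{p,\infty}=\max(|x_0|,\|y\|_p)$ on $\mathbb R\times\mathbb R^d$. Put $\lambda=\mathrm{OPT}/B$, $\varepsilon=\sqrt{(p+r)L/B}$, $\delta=\varepsilon/(p+r)$ and $$\Psi_{p,r}(x_0,y)=\tfrac1\delta\bigl((1+\delta x_0)^r+\|\mathbf 1_d+\delta y\|_p^r\bigr)^{1/r}-\tfrac1\delta .$$ Extend every cost matrix by a dummy "time" resource of which every action consumes $B/T$ per round, let $\Lambda^{(t)}=\sum_{s\le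 t}C^{(s)}x^{(s)}\in\mathbb R^{d+1}$ be the extended load, and let the surrogate reward of action $i$ in round $t$ be $R^{(t)}_i=r^{(t)}e_i-\lambda\langle C^{(t)}e_i,\nabla\Psi_{p,r}(\Lambda^{(t-1)})\rangle$ if $\|\Lambda^{(t-1)}\|_{p,\infty}\le B$ and $R^{(t)}_i=0$ otherwise. The algorithm, which is given $\mathrm{OPT}$ but not the distribution of the data, runs $\mathcal A$ on the rewards $R^{(t)}/(\lambda L+1)$ and plays its actions. **Theorem.** 1. If $B\le T L$, then for every real $r\ge1$ and every distribution of the data the algorithm satisfies $$\mathbb E\Bigl[\sum_{t=1}^{\tau}r^{(t)}x^{(t)}\Bigr]\ \ge\ \mathrm{OPT}\Bigl(1-2\sqrt{\tfrac{(p+r)L}{B}}-(2^{1/r}-1)\Bigr)-\Bigl(\mathrm{OPT}\,\tfrac{L}{B}+1\Bigr)\mathrm{Regret},$$ and hence, if $B\le \mathrm{OPT}\cdot L$, $$\mathbb E\Bigl[\sum_{t=1}^{\tau}r^{(t)}x^{(t)}\Bigr]\ \ge\ \mathrm{OPT}\Bigl(1-2\sqrt{\tfrac{(p+r)L}{B}}-(2^{1/r}-1)-2\,\tfrac{L}{B}\,\mathrm{Regret}\Bigr).$$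 2. For every $B>0$ there is an online algorithm for stochastic $\mathrm{BwK}_p$ that is given $\mathrm{OPT}$ (if $B\le TL$, it is the algorithm above with $r=\max\{1,(B/L)^{1/3}\}$) such that for every distribution of the data $$\mathbb E\Bigl[\sum_{t=1}^{\tau}r^{(t)}x^{(t)}\Bigr]\ \ge\ \mathrm{OPT}-\mathrm{OPT}\Bigl(3\bigl(\tfrac{L}{B}\bigr)^{1/3}+2\bigl(\tfrac{pL}{B}\bigr)^{1/2}\Bigr)-\Bigl(\mathrm{OPT}\,\tfrac LB+1\Bigr)\mathrm{Regret},$$ and hence, if $B\le\mathrm{OPT}\cdot L$, $$\mathbb E\Bigl[\sum_{t=1}^{\tau}r^{(t)}x^{(t)}\Bigr]\ \ge\ \mathrm{OPT}-\mathrm{OPT}\Bigl(3\bigl(\tfrac{L}{B}\bigr)^{1/3}+2\bigl(\tfrac{pL}{B}\bigr)^{1/2}+2\,\tfrac{L}{B}\,\mathrm{Regret}\Bigr).$$ -/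

import Mathlib

open MeasureTheory

noncomputable section

namespace BwK

/-- Distributions over the `n` actions. -/
abbrev Simplex (n : ℕ) : Type := stdSimplex ℝ (Fin n)

/-- The distribution that plays action `i` with probability one. -/
def pureAction {n : ℕ} (i : Fin n) : Simplex n := ⟨Pi.single i 1, single_mem_stdSimplex ℝ i⟩

/-- Matrices carry the product σ-algebra of their entries. -/
instance instMeasurableSpaceMatrix (m n : ℕ) : MeasurableSpace (Matrix (Fin m) (Fin n) ℝ) :=
  inferInstanceAs (MeasurableSpace (Fin m → Fin n → ℝ))

theorem measurable_matrix_entry {m n : ℕ} (a : Fin m) (b : Fin n) :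
    Measurable fun M : Matrix (Fin m) (Fin n) ℝ => M a b :=
  (measurable_pi_apply b).comp (measurable_pi_apply (X := fun _ : Fin m => Fin n → ℝ) a)

/-! ### Online algorithms and one-dimensional online learning -/

/-- A randomized online algorithm over `n` actions that receives an observation of type `O` after
every round. It draws a private random seed once; its action in round `t` (rounds are numbered from
`0`) is a function of the seed and of the observations of the earlier rounds. -/
structure OnlineAlgorithm (n : ℕ) (O : Type) [MeasurableSpace O] where
  Seed : Type
  [measurableSpace_seed : MeasurableSpace Seed]
  law : Measure Seed
  [isProbabilityMeasure_law : IsProbabilityMeasure law]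
  act : (t : ℕ) → Seed → (Fin t → O) → Simplex n
  measurable_act : ∀ t, Measurable fun q : Seed × (Fin t → O) => act t q.1 q.2

attribute [instance] OnlineAlgorithm.measurableSpace_seed
  OnlineAlgorithm.isProbabilityMeasure_law

/-- A (full or partial) feedback model: if `x` is played and the vector of the round is
`v : Fin n → ℝ`, then the `k` numbers `M x *ᵥ v` are revealed. -/
structure Feedback (n k : ℕ) where
  M : Simplex n → Matrix (Fin k) (Fin n) ℝ
  measurable_M : Measurable M

/-- Full feedback (experts): the whole vector `v` is revealed. -/
def Feedback.full (n : ℕ) : Feedback n n where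
  M _ := 1
  measurable_M := measurable_const

/-- Bandit feedback: only the number `v ⬝ᵥ x` is revealed. -/
def Feedback.bandit (n : ℕ) : Feedback n 1 where
  M x := Matrix.of fun _ i => (x : Fin n → ℝ) i
  measurable_M :=
    measurable_pi_lambda (X := fun _ : Fin 1 => Fin n → ℝ) _ fun _ => measurable_subtype_coe

/-- An adaptive (non-oblivious) adversary of one-dimensional online learning: the reward vector of
round `t` is a function of the actions that the learner took before. Rewards lie in `[-1, 1]`. -/
structure Adversary (n : ℕ) where
  reward : (t : ℕ) → (Fin t → Simplex n) → (Fin n → ℝ)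
  measurable_reward : ∀ t, Measurable (reward t)
  abs_reward_le : ∀ t h i, |reward t h i| ≤ 1

/-- The actions and observations of a learner in the first `t` rounds against an adversary. -/
def learnerHistory {n k : ℕ} (F : Feedback n k) (A : OnlineAlgorithm n (Fin k → ℝ))
    (adv : Adversary n) (s : A.Seed) : (t : ℕ) → Fin t → Simplex n × (Fin k → ℝ)
  | 0 => Fin.elim0
  | t + 1 =>
    let H := learnerHistory F A adv s t
    let x := A.act t s fun i => (H i).2
    Fin.snoc (α := fun _ => Simplex n × (Fin k → ℝ)) H
      (x, (F.M x).mulVec (adv.reward t fun i => (H i).1))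

/-- The action of the learner in round `t`. -/
def learnerAction {n k : ℕ} (F : Feedback n k) (A : OnlineAlgorithm n (Fin k → ℝ))
    (adv : Adversary n) (s : A.Seed) (t : ℕ) : Simplex n :=
  (learnerHistory F A adv s (t + 1) (Fin.last t)).1

/-- The reward vector that the adversary picks in round `t`. -/
def adversaryReward {n k : ℕ} (F : Feedback n k) (A : OnlineAlgorithm n (Fin k → ℝ))
    (adv : Adversary n) (s : A.Seed) (t : ℕ) : Fin n → ℝ :=
  adv.reward t fun i => (learnerHistory F A adv s t i).1

/-- `ρ` bounds the regret of the one-dimensional learner `A` over `T` rounds: against every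
adaptive adversary and every fixed distribution `x`, the expected total reward of `A` is at most `ρ`
below that of `x` on the same reward vectors. -/
def HasRegretBound {n k : ℕ} (F : Feedback n k) (A : OnlineAlgorithm n (Fin k → ℝ))
    (T : ℕ) (ρ : ℝ) : Prop :=
  ∀ (adv : Adversary n) (x : Simplex n),
    ∫ s, ∑ t ∈ Finset.range T,
      (adversaryReward F A adv s t ⬝ᵥ (x : Fin n → ℝ)
        - adversaryReward F A adv s t ⬝ᵥ (learnerAction F A adv s t : Fin n → ℝ)) ∂A.law ≤ ρ

/-! ### Norms and the smooth approximation -/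

/-- The `ℓ_p` norm on `ℝ^d`. -/
def lpNorm {d : ℕ} (p : ℝ) (v : Fin d → ℝ) : ℝ := (∑ j, |v j| ^ p) ^ (1 / p)

/-- `‖1_d‖_p`, the `ℓ_p` norm of the all-ones vector of `ℝ^d`. -/
def onesNorm (d : ℕ) (p : ℝ) : ℝ := lpNorm p (fun _ : Fin d => (1 : ℝ))

/-- The mixed norm `‖(x₀, y)‖_{p,r} = ‖(x₀, ‖y‖_p)‖_r` on `ℝ × ℝ^d`. -/
def mixedNorm {d : ℕ} (p r : ℝ) (v : ℝ × (Fin d → ℝ)) : ℝ :=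
  (|v.1| ^ r + lpNorm p v.2 ^ r) ^ (1 / r)

/-- The mixed norm `‖(x₀, y)‖_{p,∞} = max |x₀| ‖y‖_p`. -/
def mixedNormTop {d : ℕ} (p : ℝ) (v : ℝ × (Fin d → ℝ)) : ℝ := max |v.1| (lpNorm p v.2)

/-- The smooth approximation `Ψ_{p,r}` of `‖·‖_{p,r}` with parameter `δ`:
`(1/δ) ((1 + δ x₀)^r + ‖1_d + δ y‖_p^r)^{1/r} - 1/δ` on the non-negative orthant. -/
def Psi {d : ℕ} (p r δ : ℝ) (v : ℝ × (Fin d → ℝ)) : ℝ :=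
  1 / δ * mixedNorm p r (1 + δ * v.1, fun j => 1 + δ * v.2 j) - 1 / δ

/-- The gradient (vector of partial derivatives) of `Ψ_{p,r}`. -/
def gradPsi {d : ℕ} (p r δ : ℝ) (v : ℝ × (Fin d → ℝ)) : ℝ × (Fin d → ℝ) :=
  (fderiv ℝ (Psi p r δ) v (1, 0), fun j => fderiv ℝ (Psi p r δ) v (0, Pi.single j 1))

/-- The standard scalar product of `ℝ × ℝ^d`. -/
def pairing {d : ℕ} (v w : ℝ × (Fin d → ℝ)) : ℝ := v.1 * w.1 + v.2 ⬝ᵥ w.2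

/-! ### Bandits with knapsacks under an `ℓ_p` budget -/

/-- The data `(r, C)` of one round: a reward vector `r ∈ [0,1]^n` and a cost matrix
`C ∈ [0,1]^{d × n}`, where the null action `i₀` has reward `0` and cost `0`. -/
abbrev Round (n d : ℕ) (i₀ : Fin n) : Type :=
  {w : (Fin n → ℝ) × Matrix (Fin d) (Fin n) ℝ //
    (∀ i, w.1 i ∈ Set.Icc (0 : ℝ) 1) ∧ (∀ j i, w.2 j i ∈ Set.Icc (0 : ℝ) 1) ∧
      w.1 i₀ = 0 ∧ ∀ j, w.2 j i₀ = 0}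

variable {n d k : ℕ} {i₀ : Fin n}

/-- The scalar reward `r x` of playing `x`. -/
def gain (w : Round n d i₀) (x : Simplex n) : ℝ := w.1.1 ⬝ᵥ (x : Fin n → ℝ)

/-- The vector cost `C x` of playing `x`. -/
def cost (w : Round n d i₀) (x : Simplex n) : Fin d → ℝ := w.1.2.mulVec (x : Fin n → ℝ)

/-- What the algorithm knows after a round with data `(r, C)` in which `x` was played: `x` itself,
the feedback `M x *ᵥ r` on the rewards, the feedback `M x *ᵥ C_j` on each row `C_j` of the cost
matrix (as the columns of `M x * Cᵀ`), and the incurred cost `C x`. For full feedback this is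
`(x, r, Cᵀ, C x)`; for bandit feedback it is `x`, `r x` and `C x`. -/
abbrev Obs (n d k : ℕ) : Type :=
  Simplex n × (Fin k → ℝ) × Matrix (Fin k) (Fin d) ℝ × (Fin d → ℝ)

def observe (F : Feedback n k) (x : Simplex n) (w : Round n d i₀) : Obs n d k :=
  (x, (F.M x).mulVec w.1.1, F.M x * w.1.2.transpose, cost w x)

open Classical in
/-- The actions played and the data of the first `t` rounds, when the algorithm `P` is run with seed
`s` on the data `ω`. Once the `ℓ_p` norm of the accumulated cost exceeds the budget `B`, only the
null action is played. -/
def history {T : ℕ} (F : Feedback n k) (p B : ℝ) (P : OnlineAlgorithm n (Obs n d k)) (s : P.Seed)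
    (ω : Fin T → Round n d i₀) : (t : ℕ) → t ≤ T → Fin t → Simplex n × Round n d i₀
  | 0, _ => Fin.elim0
  | t + 1, h =>
    let H := history F p B P s ω t (Nat.le_of_succ_le h)
    let x := if lpNorm p (∑ i, cost (H i).2 (H i).1) ≤ B
      then P.act t s fun i => observe F (H i).1 (H i).2
      else pureAction i₀
    Fin.snoc (α := fun _ => Simplex n × Round n d i₀) H (x, ω ⟨t, h⟩)

/-- The total reward collected in the `T` rounds (hence up to the round in which the budget is
exhausted, as the null action has reward `0`). -/
def totalReward {T : ℕ} (F : Feedback n k) (p B : ℝ) (P : OnlineAlgorithm n (Obs n d k))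
    (s : P.Seed) (ω : Fin T → Round n d i₀) : ℝ :=
  ∑ i, gain (history F p B P s ω T le_rfl i).2 (history F p B P s ω T le_rfl i).1

/-- The expected total reward of `P`, when the data of the `T` rounds are drawn independently from
the distribution `μ`. -/
def expectedReward (T : ℕ) (F : Feedback n k) (p B : ℝ) (P : OnlineAlgorithm n (Obs n d k))
    (μ : Measure (Round n d i₀)) : ℝ :=
  ∫ q : P.Seed × (Fin T → Round n d i₀), totalReward F p B P q.1 q.2
    ∂(P.law.prod (Measure.pi fun _ => μ))

/-- `𝔼[∑_{t ≤ m} C^{(t)} x]`. -/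
def benchmarkLoad (T : ℕ) (μ : Measure (Round n d i₀)) (x : Simplex n) (m : ℕ) : Fin d → ℝ :=
  fun j => ∫ ω : Fin T → Round n d i₀, ∑ t with t.val < m, cost (ω t) x j
    ∂(Measure.pi fun _ => μ)

open Classical in
/-- The largest `τ ≤ T` with `‖𝔼[∑_{t ≤ τ} C^{(t)} x]‖_p ≤ B`. -/
def benchmarkTime (T : ℕ) (p B : ℝ) (μ : Measure (Round n d i₀)) (x : Simplex n) : ℕ :=
  Nat.findGreatest (fun m => lpNorm p (benchmarkLoad T μ x m) ≤ B) T

/-- `𝔼[∑_{t ≤ τ} r^{(t)} x]` for `τ = benchmarkTime`. -/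
def benchmarkReward (T : ℕ) (p B : ℝ) (μ : Measure (Round n d i₀)) (x : Simplex n) : ℝ :=
  ∫ ω : Fin T → Round n d i₀, ∑ t with t.val < benchmarkTime T p B μ x, gain (ω t) x
    ∂(Measure.pi fun _ => μ)

/-- The optimal reward of a fixed distribution over actions. -/
def OPT (T : ℕ) (p B : ℝ) (μ : Measure (Round n d i₀)) : ℝ :=
  ⨆ x : Simplex n, benchmarkReward T p B μ x

/-! ### The Lagrangian surrogate problem and the algorithm -/

/-- The parameters of the surrogate problem. -/
structure Params where
  T : ℕ
  p : ℝ
  r : ℝ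
  B : ℝ
  opt : ℝ

namespace Params

/-- `λ = OPT / B`. -/
def lam (c : Params) : ℝ := c.opt / c.B

/-- `ε = √((p + r) ‖1_d‖_p / B)`. -/
def eps (c : Params) (d : ℕ) : ℝ := √((c.p + c.r) * onesNorm d c.p / c.B)

/-- `δ = ε / (p + r)`. -/
def delta (c : Params) (d : ℕ) : ℝ := c.eps d / (c.p + c.r)

/-- The bound `λ ‖1_d‖_p + 1` by which the surrogate rewards are normalized. -/
def scale (c : Params) (d : ℕ) : ℝ := c.lam * onesNorm d c.p + 1

end Params

open Classical in
/-- The reward vector of the surrogate problem: if the load `Λ` before the round satisfies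
`‖Λ‖_{p,∞} ≤ B`, action `i` has reward `r e_i - λ ⟨C e_i, ∇Ψ_{p,r}(Λ)⟩`, where the cost vector
`C e_i` is extended by the consumption `B / T` of the dummy resource; otherwise it has reward `0`. -/
def lagrangianReward (c : Params) (Λ : ℝ × (Fin d → ℝ)) (w : Round n d i₀) : Fin n → ℝ := fun i =>
  if mixedNormTop c.p Λ ≤ c.B then
    w.1.1 i - c.lam * pairing (c.B / c.T, fun j => w.1.2 j i) (gradPsi c.p c.r (c.delta d) Λ)
  else 0

open Classical in
/-- The feedback on the normalized surrogate reward vector, computed from the observation. -/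
def surrogateObs (F : Feedback n k) (c : Params) (Λ : ℝ × (Fin d → ℝ)) (o : Obs n d k) :
    Fin k → ℝ := fun a =>
  if mixedNormTop c.p Λ ≤ c.B then
    (o.2.1 a - c.lam * pairing (c.B / c.T * ∑ i, F.M o.1 a i, o.2.2.1 a)
      (gradPsi c.p c.r (c.delta d) Λ)) / c.scale d
  else 0

/-- `surrogateObs` is the feedback `M x *ᵥ R` for the normalized surrogate reward vector `R`. -/
theorem surrogateObs_observe (F : Feedback n k) (c : Params) (Λ : ℝ × (Fin d → ℝ)) (x : Simplex n)
    (w : Round n d i₀) :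
    surrogateObs F c Λ (observe F x w) =
      (F.M x).mulVec fun i => lagrangianReward c Λ w i / c.scale d := by
  funext a
  by_cases h : mixedNormTop c.p Λ ≤ c.B
  · simp only [surrogateObs, lagrangianReward, observe, pairing, Matrix.mulVec, dotProduct, h,
      if_true, Matrix.mul_apply, Matrix.transpose_apply]
    generalize gradPsi c.p c.r (c.delta d) Λ = g
    simp only [← mul_div_assoc, ← Finset.sum_div, mul_sub, Finset.sum_sub_distrib]
    congr 2
    simp only [Finset.sum_mul, Finset.mul_sum, mul_add, Finset.sum_add_distrib]
    congr 1
    · exact Finset.sum_congr rfl fun i _ => by ring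
    · rw [Finset.sum_comm]
      exact Finset.sum_congr rfl fun i _ => Finset.sum_congr rfl fun j _ => by ring
  · simp [surrogateObs, lagrangianReward, Matrix.mulVec, dotProduct, h]

/-- The `(d+1)`-dimensional load before round `i`, computed from the observations: `B / T` per round
of the dummy resource and the incurred costs. -/
def loadBefore (c : Params) {t : ℕ} (o : Fin t → Obs n d k) (i : Fin t) : ℝ × (Fin d → ℝ) :=
  ((i : ℕ) * (c.B / c.T), ∑ j ∈ Finset.Iio i, (o j).2.2.2)

theorem measurable_gradPsi (p r δ : ℝ) :
    Measurable (gradPsi p r δ : ℝ × (Fin d → ℝ) → ℝ × (Fin d → ℝ)) :=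
  (measurable_fderiv_apply_const ℝ _ _).prodMk
    (measurable_pi_lambda _ fun _ => measurable_fderiv_apply_const ℝ _ _)

theorem measurable_surrogate (F : Feedback n k) (c : Params) {t : ℕ} :
    Measurable fun (o : Fin t → Obs n d k) (i : Fin t) =>
      surrogateObs F c (loadBefore c o i) (o i) := by
  refine measurable_pi_lambda _ fun i => measurable_pi_lambda _ fun a => ?_
  have hL : Measurable fun o : Fin t → Obs n d k => loadBefore c o i := by
    unfold loadBefore
    fun_prop
  have hN : Measurable (mixedNormTop c.p : ℝ × (Fin d → ℝ) → ℝ) := by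
    unfold mixedNormTop lpNorm
    fun_prop
  have hg := (measurable_gradPsi (d := d) c.p c.r (c.delta d)).comp hL
  have ho : Measurable fun o : Fin t → Obs n d k => o i := measurable_pi_apply i
  have hM (b : Fin n) : Measurable fun o : Fin t → Obs n d k => F.M (o i).1 a b :=
    (measurable_matrix_entry a b).comp (F.measurable_M.comp ho.fst)
  have hC (j : Fin d) : Measurable fun o : Fin t → Obs n d k => (o i).2.2.1 a j :=
    (measurable_matrix_entry a j).comp ho.snd.snd.fst
  have hr : Measurable fun o : Fin t → Obs n d k => (o i).2.1 a :=
    (measurable_pi_apply a).comp ho.snd.fst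
  unfold surrogateObs pairing dotProduct
  refine Measurable.ite (measurableSet_le (hN.comp hL) measurable_const) ?_ measurable_const
  refine (hr.sub (((((Finset.measurable_sum _ fun b _ => hM b).const_mul _).mul hg.fst).add
    (Finset.measurable_sum _ fun j _ =>
      (hC j).mul ((measurable_pi_apply j).comp hg.snd))).const_mul _)).div_const _

/-- The algorithm: run the one-dimensional learner `A` on the surrogate problem and play its
actions. -/
def lagrangianAlgorithm (d : ℕ) (F : Feedback n k) (A : OnlineAlgorithm n (Fin k → ℝ))
    (c : Params) : OnlineAlgorithm n (Obs n d k) where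
  Seed := A.Seed
  law := A.law
  act t s o := A.act t s fun i => surrogateObs F c (loadBefore c o i) (o i)
  measurable_act t := (A.measurable_act t).comp
    (measurable_fst.prodMk ((measurable_surrogate F c).comp measurable_snd))

end BwK

end

noncomputable section

namespace BwK

section

variable {d : ℕ} {p r : ℝ}

/-! ### The `ℓ_p` norm and Hölder's inequality -/

/-! The proof is a Lagrangian argument: each action is charged its extended cost at the prices `λ
∇Ψ`, and the learner faces reward minus charge. In rounds with load within the budget, its surrogate
reward plus the charge is the true reward, so the collected reward is the learner's surrogate total
plus `λ` times the total price paid. Both terms are bounded below.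

Price paid. The dummy resource brings the load to norm at least `B` by round `T` on every sample
path. The potential dominates the norm and starts at no more than `εB`; by convexity its growth is
at most the sum of costs against gradients taken after each step, and one step changes the gradient
in the real resources by a factor of at most `(1 + δ)^(p + r - 2) ≤ exp ε`. Hence the price is at
least `B (1 - 2ε)` (`Psi_pathLoad_le`, `budget_le_sum_pairing`, `budget_le_sum_open`), which
contributes `OPT (1 - 2ε)`.

Surrogate total. The learner loses at most the rescaled regret to any fixed `y`. The load before a
round is independent of the data of that round, so by Hölder `y` earns in expectation at least `𝔼[r
y] - λ ‖(B/T, 𝔼[C y])‖_{p,r}` in every open round (`integral_resample`, `comparator_le`). Diluting a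
benchmark distribution with the null action makes its mean cost at most `B/T` per round
(`exists_meanGain_eq`), so the norm is at most `2^(1/r) B/T`. Summed over at most `T` open rounds,
and with the supremum over benchmarks taken, the surrogate total falls below zero by at most `OPT
(2^(1/r) - 1)` plus regret (`OPT_mul_le_expectedReward`).

The explicit rate takes `r` to be the cube root of `B / L`, which balances `√(r L / B)` against
`2^(1/r) - 1`. A budget too large to be exceeded is handled with zero prices; for `B < L` the
claimed bound is not positive. -/

theorem lpNorm_nonneg (p : ℝ) (v : Fin d → ℝ) : 0 ≤ lpNorm p v :=
  Real.rpow_nonneg (Finset.sum_nonneg fun _ _ => Real.rpow_nonneg (abs_nonneg _) _) _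

theorem lpNorm_rpow (hp : 0 < p) (v : Fin d → ℝ) : lpNorm p v ^ p = ∑ j, |v j| ^ p := by
  unfold lpNorm
  rw [← Real.rpow_mul (Finset.sum_nonneg fun _ _ => Real.rpow_nonneg (abs_nonneg _) _),
    one_div_mul_cancel hp.ne', Real.rpow_one]

theorem lpNorm_zero (hp : 0 < p) : lpNorm p (0 : Fin d → ℝ) = 0 := by
  simp [lpNorm, Real.zero_rpow hp.ne', hp.ne']

theorem lpNorm_mono (hp : 0 < p) {v w : Fin d → ℝ} (hv : ∀ j, 0 ≤ v j) (h : ∀ j, v j ≤ w j) :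
    lpNorm p v ≤ lpNorm p w := by
  refine Real.rpow_le_rpow (Finset.sum_nonneg fun _ _ => Real.rpow_nonneg (abs_nonneg _) _)
    (Finset.sum_le_sum fun j _ => Real.rpow_le_rpow (abs_nonneg _) ?_ hp.le) (by positivity)
  rw [abs_of_nonneg (hv j), abs_of_nonneg ((hv j).trans (h j))]
  exact h j

theorem lpNorm_smul (hp : 0 < p) {a : ℝ} (ha : 0 ≤ a) (v : Fin d → ℝ) :
    lpNorm p (fun j => a * v j) = a * lpNorm p v := by
  unfold lpNorm
  simp only [abs_mul, abs_of_nonneg ha, Real.mul_rpow ha (abs_nonneg _), ← Finset.mul_sum]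
  rw [Real.mul_rpow (Real.rpow_nonneg ha _)
    (Finset.sum_nonneg fun _ _ => Real.rpow_nonneg (abs_nonneg _) _), ← Real.rpow_mul ha,
    mul_one_div_cancel hp.ne', Real.rpow_one]

theorem le_lpNorm (hp : 0 < p) (v : Fin d → ℝ) (j : Fin d) : |v j| ≤ lpNorm p v := by
  have h : |v j| ^ p ≤ lpNorm p v ^ p := by
    rw [lpNorm_rpow hp]
    exact Finset.single_le_sum (f := fun j => |v j| ^ p)
      (fun _ _ => Real.rpow_nonneg (abs_nonneg _) _) (Finset.mem_univ j)
  exact (Real.rpow_le_rpow_iff (abs_nonneg _) (lpNorm_nonneg _ _) hp).1 h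

theorem onesNorm_pos (hd : 0 < d) (hp : 0 < p) : 0 < onesNorm d p :=
  one_pos.trans_le (abs_one (α := ℝ) ▸ le_lpNorm hp (fun _ : Fin d => (1 : ℝ)) ⟨0, hd⟩)

theorem lpNorm_le_mul_onesNorm (hp : 0 < p) {v : Fin d → ℝ} {a : ℝ} (ha : 0 ≤ a)
    (hv : ∀ j, 0 ≤ v j) (h : ∀ j, v j ≤ a) : lpNorm p v ≤ a * onesNorm d p := by
  rw [onesNorm, ← lpNorm_smul hp ha]
  exact lpNorm_mono hp hv fun j => by simpa using h j

/-- Bernoulli's inequality at `b / a`, multiplied by `a ^ p`. This form of Young's inequality avoids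
the conjugate exponent and so includes `p = 1`. -/
theorem young_rpow (hp : 1 ≤ p) {a b : ℝ} (ha : 0 < a) (hb : 0 ≤ b) :
    p * (a ^ (p - 1) * b) ≤ b ^ p + (p - 1) * a ^ p := by
  have h := one_add_mul_self_le_rpow_one_add (s := b / a - 1)
    (by have := div_nonneg hb ha.le; linarith) hp
  rw [add_sub_cancel, Real.div_rpow hb ha.le, le_div_iff₀ (Real.rpow_pos_of_pos ha _)] at h
  have h2 : a ^ p = a ^ (p - 1) * a := by
    rw [← Real.rpow_add_one ha.ne', sub_add_cancel]
  have h3 : (1 + p * (b / a - 1)) * a ^ p = a ^ p + p * (a ^ (p - 1) * b) - p * a ^ p := by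
    rw [h2]
    field_simp
    ring
  linarith

/-- Hölder's inequality for the gradient of the `ℓ_p` norm at `u`. -/
theorem sum_div_lpNorm_rpow_mul_le (hp : 1 ≤ p) {u v : Fin d → ℝ} (hu : ∀ j, 0 < u j)
    (hv : ∀ j, 0 ≤ v j) : ∑ j, (u j / lpNorm p u) ^ (p - 1) * v j ≤ lpNorm p v := by
  have hp0 : 0 < p := by linarith
  rcases (lpNorm_nonneg p v).eq_or_lt' with h0 | hV
  · refine (Finset.sum_nonpos fun j _ => ?_).trans h0.ge
    have : |v j| ≤ 0 := h0 ▸ le_lpNorm hp0 v j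
    simp [abs_nonpos_iff.1 this]
  rcases Nat.eq_zero_or_pos d with rfl | hd
  · simpa using hV.le
  have hU : 0 < lpNorm p u := (abs_pos.2 (hu ⟨0, hd⟩).ne').trans_le (le_lpNorm hp0 u _)
  -- Young's inequality on the normalised vectors, whose `p`-th powers sum to one: the total is `1 +
  -- (p - 1)`.
  have key : ∑ j, p * ((u j / lpNorm p u) ^ (p - 1) * (v j / lpNorm p v)) ≤ p := by
    calc _ ≤ ∑ j, ((v j / lpNorm p v) ^ p + (p - 1) * (u j / lpNorm p u) ^ p) :=
          Finset.sum_le_sum fun j _ => young_rpow hp (div_pos (hu j) hU) (div_nonneg (hv j) hV.le)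
      _ = p := by
          have e {w : Fin d → ℝ} (hw : ∀ j, 0 ≤ w j) (hW : 0 < lpNorm p w) :
              ∑ j, (w j / lpNorm p w) ^ p = 1 := by
            simp only [fun j => Real.div_rpow (hw j) hW.le p, ← Finset.sum_div]
            rw [lpNorm_rpow hp0, div_eq_one_iff_eq]
            · exact Finset.sum_congr rfl fun j _ => by rw [abs_of_nonneg (hw j)]
            · rw [← lpNorm_rpow hp0]
              exact (Real.rpow_pos_of_pos hW _).ne'
          rw [Finset.sum_add_distrib, ← Finset.mul_sum, e hv hV, e (fun j => (hu j).le) hU]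
          ring
  rw [← Finset.mul_sum] at key
  simp only [← mul_div_assoc, ← Finset.sum_div] at key
  rw [div_le_iff₀ hV] at key
  exact le_of_mul_le_mul_left key hp0

/-- Euler's identity for a function homogeneous of degree one; it is the equality case of the Hölder
bound. -/
theorem sum_div_lpNorm_rpow_mul_self (hp : 1 ≤ p) (hd : 0 < d) {u : Fin d → ℝ}
    (hu : ∀ j, 0 < u j) : ∑ j, (u j / lpNorm p u) ^ (p - 1) * u j = lpNorm p u := by
  have hp0 : 0 < p := by linarith
  have hU : 0 < lpNorm p u := (abs_pos.2 (hu ⟨0, hd⟩).ne').trans_le (le_lpNorm hp0 u _)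
  have e (j) : (u j / lpNorm p u) ^ (p - 1) * u j = |u j| ^ p / lpNorm p u ^ (p - 1) := by
    rw [Real.div_rpow (hu j).le hU.le, div_mul_eq_mul_div, ← Real.rpow_add_one (hu j).ne',
      sub_add_cancel, abs_of_pos (hu j)]
  simp only [e, ← Finset.sum_div]
  rw [← lpNorm_rpow hp0, ← Real.rpow_sub hU]
  simp

/-! ### The mixed norm -/

/-- Reduces the mixed norm to an `ℓ_r` norm in dimension two, so that monotonicity, Hölder, Euler
and differentiability need to be proved only for `lpNorm`. -/
theorem mixedNorm_eq_lpNorm (v : ℝ × (Fin d → ℝ)) :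
    mixedNorm p r v = lpNorm r ![v.1, lpNorm p v.2] := by
  rw [mixedNorm, lpNorm.eq_def r]
  simp [Fin.sum_univ_two, abs_of_nonneg (lpNorm_nonneg p v.2)]

theorem lpNorm_two_mono (hr : 0 < r) {a b a' b' : ℝ} (ha : 0 ≤ a) (hb : 0 ≤ b) (haa : a ≤ a')
    (hbb : b ≤ b') : lpNorm r ![a, b] ≤ lpNorm r ![a', b'] :=
  lpNorm_mono hr (Fin.forall_fin_two.2 ⟨ha, hb⟩) (Fin.forall_fin_two.2 ⟨haa, hbb⟩)

theorem mixedNorm_mono (hp : 0 < p) (hr : 0 < r) {v w : ℝ × (Fin d → ℝ)} (h0 : 0 ≤ v.1)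
    (h1 : ∀ j, 0 ≤ v.2 j) (h2 : v.1 ≤ w.1) (h3 : ∀ j, v.2 j ≤ w.2 j) :
    mixedNorm p r v ≤ mixedNorm p r w := by
  rw [mixedNorm_eq_lpNorm, mixedNorm_eq_lpNorm]
  exact lpNorm_two_mono hr h0 (lpNorm_nonneg _ _) h2 (lpNorm_mono hp h1 h3)

theorem fst_le_mixedNorm (hr : 0 < r) (v : ℝ × (Fin d → ℝ)) : |v.1| ≤ mixedNorm p r v := by
  rw [mixedNorm_eq_lpNorm]
  exact le_lpNorm hr ![v.1, lpNorm p v.2] 0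

theorem lpNorm_le_mixedNorm (hr : 0 < r) (v : ℝ × (Fin d → ℝ)) :
    lpNorm p v.2 ≤ mixedNorm p r v := by
  rw [mixedNorm_eq_lpNorm]
  exact (le_abs_self _).trans (le_lpNorm hr ![v.1, lpNorm p v.2] 1)

/-- The source of the loss `2^(1/r) - 1`: the price of replacing the maximum of two numbers by a
smooth `ℓ_r` norm. -/
theorem mixedNorm_le_two_rpow_mul (hr : 0 < r) {v : ℝ × (Fin d → ℝ)} {b : ℝ} (hb : 0 ≤ b)
    (h0 : |v.1| ≤ b) (h1 : lpNorm p v.2 ≤ b) : mixedNorm p r v ≤ (2 : ℝ) ^ (1 / r) * b := by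
  have h := Real.rpow_le_rpow (z := 1 / r) (add_nonneg (Real.rpow_nonneg (abs_nonneg v.1) r)
    (Real.rpow_nonneg (lpNorm_nonneg p v.2) r)) (add_le_add
      (Real.rpow_le_rpow (abs_nonneg _) h0 hr.le)
      (Real.rpow_le_rpow (lpNorm_nonneg _ _) h1 hr.le)) (by positivity)
  refine h.trans (le_of_eq ?_)
  rw [← two_mul, Real.mul_rpow zero_le_two (Real.rpow_nonneg hb _), ← Real.rpow_mul hb,
    mul_one_div_cancel hr.ne', Real.rpow_one]

theorem mixedNorm_le_add (hr : 1 ≤ r) (v : ℝ × (Fin d → ℝ)) :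
    mixedNorm p r v ≤ |v.1| + lpNorm p v.2 :=
  Real.rpow_add_rpow_le_add (abs_nonneg _) (lpNorm_nonneg _ _) hr

end

section

variable {d : ℕ} {p r δ : ℝ}

theorem lpNorm_pos (hp : 0 < p) (hd : 0 < d) {u : Fin d → ℝ} (hu : ∀ j, 0 < u j) :
    0 < lpNorm p u :=
  (abs_pos.2 (hu ⟨0, hd⟩).ne').trans_le (le_lpNorm hp u _)

/-! ### The gradient of the potential -/

theorem hasFDerivAt_lpNorm (hp : 1 ≤ p) (hd : 0 < d) {u : Fin d → ℝ} (hu : ∀ j, 0 < u j) :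
    HasFDerivAt (lpNorm p : (Fin d → ℝ) → ℝ)
      (∑ j, (u j / lpNorm p u) ^ (p - 1) • (ContinuousLinearMap.proj j : (Fin d → ℝ) →L[ℝ] ℝ))
      u := by
  have hp0 : 0 < p := by linarith
  have hU := lpNorm_pos hp0 hd hu
  have h1 : HasFDerivAt (fun v : Fin d → ℝ => ∑ j, |v j| ^ p)
      (∑ j, (p * u j ^ (p - 1)) • (ContinuousLinearMap.proj j : (Fin d → ℝ) →L[ℝ] ℝ)) u := by
    refine HasFDerivAt.fun_sum fun j _ => ?_
    have h := ((hasDerivAt_abs_pos (hu j)).rpow_const (p := p) (Or.inr hp)).comp_hasFDerivAt u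
      (ContinuousLinearMap.proj (R := ℝ) (φ := fun _ : Fin d => ℝ) j).hasFDerivAt
    refine h.congr_fderiv ?_
    rw [abs_of_pos (hu j), one_mul]
  have hs : ∑ j, |u j| ^ p = lpNorm p u ^ p := (lpNorm_rpow hp0 u).symm
  have h2 := h1.rpow_const (p := 1 / p) (Or.inl (by rw [hs]; positivity))
  refine h2.congr_fderiv ?_
  rw [hs, Finset.smul_sum]
  refine Finset.sum_congr rfl fun j _ => ?_
  rw [smul_smul, ← Real.rpow_mul hU.le, Real.div_rpow (hu j).le hU.le]
  congr 1
  rw [show p * (1 / p - 1) = -(p - 1) by field_simp; ring, Real.rpow_neg hU.le]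
  field_simp

/-- The argument `1 + δ v` of the mixed norm in the potential. -/
def shift (δ : ℝ) (v : ℝ × (Fin d → ℝ)) : ℝ × (Fin d → ℝ) := (1 + δ * v.1, fun j => 1 + δ * v.2 j)

theorem shift_pos (hδ : 0 < δ) {v : ℝ × (Fin d → ℝ)} (h0 : 0 ≤ v.1) (h1 : ∀ j, 0 ≤ v.2 j) :
    1 ≤ (shift δ v).1 ∧ ∀ j, 1 ≤ (shift δ v).2 j :=
  ⟨le_add_of_nonneg_right (mul_nonneg hδ.le h0),
    fun j => le_add_of_nonneg_right (mul_nonneg hδ.le (h1 j))⟩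

theorem Psi_eq (p r δ : ℝ) (v : ℝ × (Fin d → ℝ)) :
    Psi p r δ v = 1 / δ * mixedNorm p r (shift δ v) - 1 / δ := rfl

/-- Chain rule through the two nested norms; the inner factor `δ` cancels the outer `1 / δ`. The
shift by one keeps every coordinate positive, so the norms are differentiable even at load zero. -/
theorem gradPsi_eq (hd : 0 < d) (hp : 1 ≤ p) (hr : 1 ≤ r) (hδ : 0 < δ) {v : ℝ × (Fin d → ℝ)}
    (h0 : 0 ≤ v.1) (h1 : ∀ j, 0 ≤ v.2 j) :
    gradPsi p r δ v = (((shift δ v).1 / mixedNorm p r (shift δ v)) ^ (r - 1),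
      fun j => ((shift δ v).2 j / lpNorm p (shift δ v).2) ^ (p - 1)
        * (lpNorm p (shift δ v).2 / mixedNorm p r (shift δ v)) ^ (r - 1)) := by
  have hp0 : 0 < p := by linarith
  obtain ⟨ha, hy⟩ := shift_pos hδ h0 h1
  have hy' (j) : 0 < (shift δ v).2 j := one_pos.trans_le (hy j)
  have hS := lpNorm_pos hp0 hd hy'
  have hy1 : HasFDerivAt (fun v : ℝ × (Fin d → ℝ) => fun j => 1 + δ * v.2 j)
      (δ • ContinuousLinearMap.snd ℝ ℝ (Fin d → ℝ)) v :=
    ((hasFDerivAt_snd (𝕜 := ℝ) (p := v)).const_smul δ).const_add (fun _ => 1)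
  have ha1 : HasFDerivAt (fun v : ℝ × (Fin d → ℝ) => 1 + δ * v.1)
      (δ • ContinuousLinearMap.fst ℝ ℝ (Fin d → ℝ)) v :=
    ((hasFDerivAt_fst (𝕜 := ℝ) (p := v)).const_smul δ).const_add 1
  have hS1 := (hasFDerivAt_lpNorm hp hd hy').comp v hy1
  have h2 : HasFDerivAt (fun v : ℝ × (Fin d → ℝ) =>
      ![1 + δ * v.1, lpNorm p fun j => 1 + δ * v.2 j])
      (ContinuousLinearMap.pi ![δ • ContinuousLinearMap.fst ℝ ℝ (Fin d → ℝ),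
        (∑ j, ((shift δ v).2 j / lpNorm p (shift δ v).2) ^ (p - 1) •
          (ContinuousLinearMap.proj j : (Fin d → ℝ) →L[ℝ] ℝ)).comp
            (δ • ContinuousLinearMap.snd ℝ ℝ (Fin d → ℝ))]) v := by
    rw [hasFDerivAt_pi']
    exact Fin.forall_fin_two.2 ⟨ha1, hS1⟩
  have h3 := (hasFDerivAt_lpNorm hr two_pos (u := ![(shift δ v).1, lpNorm p (shift δ v).2])
    (Fin.forall_fin_two.2 ⟨one_pos.trans_le ha, hS⟩)).comp v h2
  have h4 : HasFDerivAt (Psi p r δ) _ v :=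
    ((h3.const_mul (1 / δ)).sub_const (1 / δ)).congr_of_eventuallyEq
      (Filter.Eventually.of_forall fun w => by
        rw [Psi_eq, mixedNorm_eq_lpNorm]
        rfl)
  rw [gradPsi, h4.fderiv, mixedNorm_eq_lpNorm]
  ext j
  · simp [Fin.sum_univ_two]
    field_simp
  · simp [Fin.sum_univ_two, Pi.single_apply]
    field_simp

end

/-! ### Duality, convexity and stability of the potential -/

section

variable {d : ℕ} {p r δ : ℝ}

/-- Hölder twice: with exponent `p` among the resources, then with exponent `r` on the pair formed
by the dummy coordinate and the `ℓ_p` norm. -/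
theorem pairing_grad_le_mixedNorm (hp : 1 ≤ p) (hr : 1 ≤ r) (hd : 0 < d)
    {u v : ℝ × (Fin d → ℝ)} (hu0 : 0 < u.1) (hu1 : ∀ j, 0 < u.2 j) (hv0 : 0 ≤ v.1)
    (hv1 : ∀ j, 0 ≤ v.2 j) :
    pairing v ((u.1 / mixedNorm p r u) ^ (r - 1),
      fun j => (u.2 j / lpNorm p u.2) ^ (p - 1) * (lpNorm p u.2 / mixedNorm p r u) ^ (r - 1))
      ≤ mixedNorm p r v := by
  have hS := lpNorm_pos (zero_lt_one.trans_le hp) hd hu1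
  have h := sum_div_lpNorm_rpow_mul_le hr (u := ![u.1, lpNorm p u.2]) (v := ![v.1, lpNorm p v.2])
    (Fin.forall_fin_two.2 ⟨hu0, hS⟩) (Fin.forall_fin_two.2 ⟨hv0, lpNorm_nonneg _ _⟩)
  rw [← mixedNorm_eq_lpNorm, ← mixedNorm_eq_lpNorm, Fin.sum_univ_two] at h
  refine le_trans ?_ h
  have h2 := mul_le_mul_of_nonneg_left (sum_div_lpNorm_rpow_mul_le hp hu1 hv1)
    (Real.rpow_nonneg (div_nonneg hS.le (hS.le.trans (lpNorm_le_mixedNorm (p := p) (r := r)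
      (by linarith) u))) (r - 1))
  rw [Finset.mul_sum] at h2
  simp only [pairing, dotProduct, Matrix.cons_val_zero, Matrix.cons_val_one]
  refine add_le_add (mul_comm _ _).le (le_trans (le_of_eq ?_) h2)
  exact Finset.sum_congr rfl fun j _ => by ring

theorem pairing_grad_self (hp : 1 ≤ p) (hr : 1 ≤ r) (hd : 0 < d)
    {u : ℝ × (Fin d → ℝ)} (hu0 : 0 < u.1) (hu1 : ∀ j, 0 < u.2 j) :
    pairing u ((u.1 / mixedNorm p r u) ^ (r - 1),
      fun j => (u.2 j / lpNorm p u.2) ^ (p - 1) * (lpNorm p u.2 / mixedNorm p r u) ^ (r - 1))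
      = mixedNorm p r u := by
  have hS := lpNorm_pos (zero_lt_one.trans_le hp) hd hu1
  have h := sum_div_lpNorm_rpow_mul_self hr two_pos (u := ![u.1, lpNorm p u.2])
    (Fin.forall_fin_two.2 ⟨hu0, hS⟩)
  rw [← mixedNorm_eq_lpNorm, Fin.sum_univ_two] at h
  refine Eq.trans ?_ h
  have h2 := congrArg (fun z => (lpNorm p u.2 / mixedNorm p r u) ^ (r - 1) * z)
    (sum_div_lpNorm_rpow_mul_self hp hd hu1)
  simp only [Finset.mul_sum] at h2
  simp only [pairing, dotProduct, Matrix.cons_val_zero, Matrix.cons_val_one]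
  rw [← h2]
  exact congrArg₂ (· + ·) (mul_comm _ _) (Finset.sum_congr rfl fun j _ => by ring)

theorem pairing_add_left (v v' w : ℝ × (Fin d → ℝ)) :
    pairing (v + v') w = pairing v w + pairing v' w := by
  simp only [pairing, Prod.fst_add, Prod.snd_add, add_dotProduct]
  ring

theorem pairing_smul_left (a : ℝ) (v w : ℝ × (Fin d → ℝ)) :
    pairing (a • v) w = a * pairing v w := by
  simp only [pairing, Prod.smul_fst, Prod.smul_snd, smul_dotProduct, smul_eq_mul]
  ring

section Orthant

variable (hd : 0 < d) (hp : 1 ≤ p) (hr : 1 ≤ r) (hδ : 0 < δ) {v v' w : ℝ × (Fin d → ℝ)}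
  (hv0 : 0 ≤ v.1) (hv1 : ∀ j, 0 ≤ v.2 j)
include hd hp hr hδ hv0 hv1

theorem pairing_gradPsi_le (hw0 : 0 ≤ w.1) (hw1 : ∀ j, 0 ≤ w.2 j) :
    pairing w (gradPsi p r δ v) ≤ mixedNorm p r w := by
  obtain ⟨ha, hy⟩ := shift_pos hδ hv0 hv1
  rw [gradPsi_eq hd hp hr hδ hv0 hv1]
  exact pairing_grad_le_mixedNorm hp hr hd (one_pos.trans_le ha)
    (fun j => one_pos.trans_le (hy j)) hw0 hw1

theorem gradPsi_nonneg : 0 ≤ (gradPsi p r δ v).1 ∧ ∀ j, 0 ≤ (gradPsi p r δ v).2 j := by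
  obtain ⟨ha, hy⟩ := shift_pos hδ hv0 hv1
  have hN : 0 ≤ mixedNorm p r (shift δ v) :=
    (abs_nonneg _).trans (fst_le_mixedNorm (by linarith) _)
  rw [gradPsi_eq hd hp hr hδ hv0 hv1]
  exact ⟨Real.rpow_nonneg (div_nonneg (zero_le_one.trans ha) hN) _, fun j => mul_nonneg
    (Real.rpow_nonneg (div_nonneg (zero_le_one.trans (hy j)) (lpNorm_nonneg _ _)) _)
    (Real.rpow_nonneg (div_nonneg (lpNorm_nonneg _ _) hN) _)⟩

theorem gradPsi_fst_le_one : (gradPsi p r δ v).1 ≤ 1 := by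
  have h := pairing_gradPsi_le hd hp hr hδ hv0 hv1 (w := (1, 0)) zero_le_one fun _ => le_rfl
  refine (le_of_eq ?_).trans (h.trans ((mixedNorm_le_add hr _).trans ?_))
  · simp [pairing]
  · simp [lpNorm_zero (zero_lt_one.trans_le hp)]

theorem dotProduct_gradPsi_snd_le {y : Fin d → ℝ} (hy : ∀ j, 0 ≤ y j) :
    y ⬝ᵥ (gradPsi p r δ v).2 ≤ lpNorm p y := by
  have h := pairing_gradPsi_le hd hp hr hδ hv0 hv1 (w := (0, y)) le_rfl hy
  refine (le_of_eq ?_).trans (h.trans ((mixedNorm_le_add hr _).trans ?_))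
  · simp [pairing]
  · simp

/-- Convexity of the potential. -/
theorem Psi_add_sub_le (hw0 : 0 ≤ w.1) (hw1 : ∀ j, 0 ≤ w.2 j) :
    Psi p r δ (v + w) - Psi p r δ v ≤ pairing w (gradPsi p r δ (v + w)) := by
  obtain ⟨ha, hy⟩ := shift_pos hδ hv0 hv1
  have h0 : 0 ≤ (v + w).1 := add_nonneg hv0 hw0
  have h1 (j) : 0 ≤ (v + w).2 j := add_nonneg (hv1 j) (hw1 j)
  obtain ⟨ha', hy'⟩ := shift_pos hδ h0 h1
  -- Euler's identity at the endpoint, minus Hölder for the starting point against the same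
  -- gradient, is the tangent inequality.
  have e1 := pairing_grad_self hp hr hd (one_pos.trans_le ha') (fun j => one_pos.trans_le (hy' j))
  have e2 := pairing_grad_le_mixedNorm (v := shift δ v) hp hr hd (one_pos.trans_le ha')
    (fun j => one_pos.trans_le (hy' j)) (zero_le_one.trans ha) (fun j => zero_le_one.trans (hy j))
  rw [← gradPsi_eq hd hp hr hδ h0 h1] at e1 e2
  have e3 : shift δ (v + w) = shift δ v + δ • w := by
    ext
    · simp [shift]; ring
    · simp [shift]; ring
  nth_rewrite 1 [e3] at e1
  rw [pairing_add_left, pairing_smul_left] at e1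
  have e4 : mixedNorm p r (shift δ (v + w)) - mixedNorm p r (shift δ v)
      ≤ δ * pairing w (gradPsi p r δ (v + w)) := by linarith
  rw [Psi_eq, Psi_eq, sub_sub_sub_cancel_right, ← mul_sub, one_div, inv_mul_le_iff₀ hδ]
  exact e4

/-- Stability of the gradient. -/
theorem gradPsi_add_snd_le (hw0 : 0 ≤ w.1) (hw1 : ∀ j, 0 ≤ w.2 j) (hw2 : ∀ j, w.2 j ≤ 1)
    (j : Fin d) :
    (gradPsi p r δ (v + w)).2 j ≤ (1 + δ) ^ (p + r - 2) * (gradPsi p r δ v).2 j := by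
  obtain ⟨ha, hy⟩ := shift_pos hδ hv0 hv1
  have h0 : 0 ≤ (v + w).1 := add_nonneg hv0 hw0
  have h1 (j) : 0 ≤ (v + w).2 j := add_nonneg (hv1 j) (hw1 j)
  obtain ⟨ha', hy'⟩ := shift_pos hδ h0 h1
  have hp0 : 0 < p := by linarith
  have hr0 : 0 < r := by linarith
  have hy0 (j) : 0 ≤ (shift δ v).2 j := zero_le_one.trans (hy j)
  have ha2 : (shift δ v).1 ≤ (shift δ (v + w)).1 := by
    simp only [shift, Prod.fst_add]
    nlinarith
  have hy2 (j) : (shift δ v).2 j ≤ (shift δ (v + w)).2 j := by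
    simp only [shift, Prod.snd_add, Pi.add_apply]
    nlinarith [hw1 j]
  -- The shifted coordinates are at least one and the costs at most one, so an additive step of `δ`
  -- is at most a multiplicative step of `1 + δ`.
  have hy3 (j) : (shift δ (v + w)).2 j ≤ (1 + δ) * (shift δ v).2 j := by
    have : (shift δ (v + w)).2 j = (shift δ v).2 j + δ * w.2 j := by
      simp only [shift, Prod.snd_add, Pi.add_apply]
      ring
    rw [this]
    nlinarith [hw2 j, hy j]
  have hS := lpNorm_pos hp0 hd fun j => one_pos.trans_le (hy j)
  have hS' := lpNorm_pos hp0 hd fun j => one_pos.trans_le (hy' j)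
  have hS2 : lpNorm p (shift δ v).2 ≤ lpNorm p (shift δ (v + w)).2 := lpNorm_mono hp0 hy0 hy2
  have hS3 : lpNorm p (shift δ (v + w)).2 ≤ (1 + δ) * lpNorm p (shift δ v).2 := by
    rw [← lpNorm_smul hp0 (by linarith)]
    exact lpNorm_mono hp0 (fun j => zero_le_one.trans (hy' j)) hy3
  have hN : 0 < mixedNorm p r (shift δ v) := hS.trans_le (lpNorm_le_mixedNorm hr0 _)
  have hN2 : mixedNorm p r (shift δ v) ≤ mixedNorm p r (shift δ (v + w)) :=
    mixedNorm_mono hp0 hr0 (zero_le_one.trans ha) hy0 ha2 hy2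
  rw [gradPsi_eq hd hp hr hδ hv0 hv1, gradPsi_eq hd hp hr hδ h0 h1]
  -- Numerators grow by at most `1 + δ` and denominators do not shrink. The dummy coordinate enters
  -- only a denominator, so its increment needs no upper bound.
  have f1 : (shift δ (v + w)).2 j / lpNorm p (shift δ (v + w)).2
      ≤ (1 + δ) * ((shift δ v).2 j / lpNorm p (shift δ v).2) := by
    rw [← mul_div_assoc]
    exact div_le_div₀ (mul_nonneg (by linarith) (hy0 j)) (hy3 j) hS hS2
  have f2 : lpNorm p (shift δ (v + w)).2 / mixedNorm p r (shift δ (v + w))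
      ≤ (1 + δ) * (lpNorm p (shift δ v).2 / mixedNorm p r (shift δ v)) := by
    rw [← mul_div_assoc]
    exact div_le_div₀ (mul_nonneg (by linarith) hS.le) hS3 hN hN2
  have g1 := Real.rpow_le_rpow (z := p - 1)
    (div_nonneg (zero_le_one.trans (hy' j)) hS'.le) f1 (by linarith)
  have g2 := Real.rpow_le_rpow (z := r - 1)
    (div_nonneg hS'.le (hN.le.trans hN2)) f2 (by linarith)
  have hδ1 : 0 < 1 + δ := by linarith
  rw [Real.mul_rpow hδ1.le (div_nonneg (hy0 j) hS.le)] at g1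
  rw [Real.mul_rpow hδ1.le (div_nonneg hS.le hN.le)] at g2
  refine (mul_le_mul g1 g2 (Real.rpow_nonneg (div_nonneg hS'.le (hN.le.trans hN2)) _)
    (mul_nonneg (Real.rpow_nonneg hδ1.le _)
      (Real.rpow_nonneg (div_nonneg (hy0 j) hS.le) _))).trans (le_of_eq ?_)
  rw [show p + r - 2 = (p - 1) + (r - 1) by ring, Real.rpow_add hδ1]
  ring

theorem mixedNormTop_le_Psi : mixedNormTop p v ≤ Psi p r δ v := by
  obtain ⟨ha, hy⟩ := shift_pos hδ hv0 hv1
  have hp0 : 0 < p := by linarith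
  have hr0 : 0 < r := by linarith
  have key : ∀ z, 1 + δ * z ≤ mixedNorm p r (shift δ v) → z ≤ Psi p r δ v := fun z hz => by
    rw [Psi_eq, ← mul_sub_one, one_div, le_inv_mul_iff₀ hδ]
    linarith
  refine max_le (key _ ?_) (key _ ?_)
  · rw [abs_of_nonneg hv0]
    exact (le_abs_self _).trans (fst_le_mixedNorm hr0 (shift δ v))
  refine le_trans ?_ (lpNorm_le_mixedNorm hr0 _)
  rcases (lpNorm_nonneg p v.2).eq_or_lt' with hS | hS
  · rw [hS, mul_zero, add_zero]
    exact (hy ⟨0, hd⟩).trans ((le_abs_self _).trans (le_lpNorm hp0 _ _))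
  -- Since each `v_j / ‖v‖` is at most one, `1 + δ v` dominates a multiple of `v` of norm exactly `1
  -- + δ ‖v‖`.
  have h := lpNorm_mono hp0 (v := fun j => (1 / lpNorm p v.2 + δ) * v.2 j) (w := (shift δ v).2)
    (fun j => mul_nonneg (by positivity) (hv1 j)) fun j => by
      have : 1 / lpNorm p v.2 * v.2 j ≤ 1 := by
        rw [one_div, inv_mul_le_iff₀ hS, mul_one]
        exact (le_abs_self _).trans (le_lpNorm hp0 _ _)
      simp only [shift]
      linarith
  rw [lpNorm_smul hp0 (by positivity)] at h
  refine le_trans (le_of_eq ?_) h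
  field_simp

end Orthant

/-- The shifted argument at zero has mixed norm at most `1 + L`, and the subtracted `1 / δ` removes
the one. -/
theorem Psi_zero_le (hr : 1 ≤ r) (hδ : 0 < δ) :
    Psi p r δ (0 : ℝ × (Fin d → ℝ)) ≤ onesNorm d p / δ := by
  have h := mixedNorm_le_add (p := p) hr (shift δ (0 : ℝ × (Fin d → ℝ)))
  have e : shift δ (0 : ℝ × (Fin d → ℝ)) = (1, fun _ => 1) := by simp [shift]
  rw [e, abs_one, ← onesNorm.eq_def] at h
  rw [Psi_eq, e, ← mul_sub_one, one_div, div_eq_inv_mul]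
  exact mul_le_mul_of_nonneg_left (by linarith) (inv_nonneg.2 hδ.le)

/-! ### The potential along a path of loads -/

/-- The extended load after `m` rounds with costs `c`, where the dummy resource is consumed at the
rate `b`. -/
def pathLoad (b : ℝ) (c : ℕ → Fin d → ℝ) (m : ℕ) : ℝ × (Fin d → ℝ) :=
  (m * b, ∑ i ∈ Finset.range m, c i)

theorem pathLoad_zero (b : ℝ) (c : ℕ → Fin d → ℝ) : pathLoad b c 0 = 0 := by
  simp [pathLoad]

theorem pathLoad_succ (b : ℝ) (c : ℕ → Fin d → ℝ) (m : ℕ) :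
    pathLoad b c (m + 1) = pathLoad b c m + (b, c m) := by
  ext
  · simp [pathLoad]; ring
  · simp [pathLoad, Finset.sum_range_succ]

theorem pathLoad_nonneg {b : ℝ} (hb : 0 ≤ b) {c : ℕ → Fin d → ℝ} (hc : ∀ i j, 0 ≤ c i j) (m : ℕ) :
    0 ≤ (pathLoad b c m).1 ∧ ∀ j, 0 ≤ (pathLoad b c m).2 j := by
  refine ⟨by unfold pathLoad; positivity, fun j => ?_⟩
  simp only [pathLoad, Finset.sum_apply]
  exact Finset.sum_nonneg fun i _ => hc i j

/-- Convexity prices each step at the gradient after it, whereas the algorithm uses the gradient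
before it. Stability bridges this for the real resources. The dummy step `b` may exceed one, which
rules out the same factor; but `b` is constant, so there the differences of gradients telescope to
the last term. -/
theorem Psi_pathLoad_le (hd : 0 < d) (hp : 1 ≤ p) (hr : 1 ≤ r) (hδ : 0 < δ) {b : ℝ} (hb : 0 ≤ b)
    {c : ℕ → Fin d → ℝ} (hc0 : ∀ i j, 0 ≤ c i j) (hc1 : ∀ i j, c i j ≤ 1) (m : ℕ) :
    Psi p r δ (pathLoad b c m) - Psi p r δ (0 : ℝ × (Fin d → ℝ))
      ≤ (1 + δ) ^ (p + r - 2)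
          * ∑ i ∈ Finset.range m, pairing (b, c i) (gradPsi p r δ (pathLoad b c i))
        + b * ((gradPsi p r δ (pathLoad b c m)).1
          - (gradPsi p r δ (0 : ℝ × (Fin d → ℝ))).1) := by
  have hκ : 1 ≤ (1 + δ) ^ (p + r - 2) := Real.one_le_rpow (by linarith) (by linarith)
  induction m with
  | zero => simp [pathLoad_zero]
  | succ m ih =>
    obtain ⟨h0, h1⟩ := pathLoad_nonneg hb hc0 m
    have e1 := Psi_add_sub_le hd hp hr hδ h0 h1 (w := (b, c m)) hb (hc0 m)
    have e2 : c m ⬝ᵥ (gradPsi p r δ (pathLoad b c m + (b, c m))).2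
        ≤ (1 + δ) ^ (p + r - 2) * (c m ⬝ᵥ (gradPsi p r δ (pathLoad b c m)).2) := by
      simp only [dotProduct, Finset.mul_sum]
      refine Finset.sum_le_sum fun j _ => ?_
      have := mul_le_mul_of_nonneg_left
        (gradPsi_add_snd_le hd hp hr hδ h0 h1 (w := (b, c m)) hb (hc0 m) (hc1 m) j) (hc0 m j)
      linarith
    have e3 : b * (gradPsi p r δ (pathLoad b c m)).1
        ≤ (1 + δ) ^ (p + r - 2) * (b * (gradPsi p r δ (pathLoad b c m)).1) :=
      le_mul_of_one_le_left (mul_nonneg hb (gradPsi_nonneg hd hp hr hδ h0 h1).1) hκ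
    rw [Finset.sum_range_succ, pathLoad_succ]
    simp only [pairing] at e1 ih ⊢
    linarith

/-- If the load reaches the budget, the total price paid for the costs is almost the budget. -/
theorem budget_le_sum_pairing (c : Params) (hd : 0 < d) (hp : 1 ≤ c.p) (hr : 1 ≤ c.r)
    (hB : 0 < c.B) {b : ℝ} (hb : 0 ≤ b) (hbL : b ≤ onesNorm d c.p) {a : ℕ → Fin d → ℝ}
    (ha0 : ∀ i j, 0 ≤ a i j) (ha1 : ∀ i j, a i j ≤ 1) {m : ℕ}
    (hm : c.B ≤ mixedNormTop c.p (pathLoad b a m)) :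
    c.B * (1 - 2 * c.eps d) ≤ ∑ i ∈ Finset.range m,
      pairing (b, a i) (gradPsi c.p c.r (c.delta d) (pathLoad b a i)) := by
  have hL := onesNorm_pos hd (zero_lt_one.trans_le hp)
  have hpr : 0 < c.p + c.r := by linarith
  have hε : 0 < c.eps d := Real.sqrt_pos.2 (by positivity)
  have hδ : 0 < c.delta d := div_pos hε hpr
  have hε2 : c.eps d ^ 2 * c.B = (c.p + c.r) * onesNorm d c.p := by
    rw [Params.eps, Real.sq_sqrt (by positivity)]
    field_simp
  set S := ∑ i ∈ Finset.range m,
      pairing (b, a i) (gradPsi c.p c.r (c.delta d) (pathLoad b a i)) with hSdef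
  have hS : 0 ≤ S := Finset.sum_nonneg fun i _ => by
    obtain ⟨h0, h1⟩ := pathLoad_nonneg hb ha0 i
    obtain ⟨g0, g1⟩ := gradPsi_nonneg hd hp hr hδ h0 h1
    exact add_nonneg (mul_nonneg hb g0) (Finset.sum_nonneg fun j _ => mul_nonneg (ha0 i j) (g1 j))
  -- For `ε ≥ 1` the left side is not positive; otherwise multiplication by `1 - ε` preserves
  -- inequalities.
  rcases le_or_gt 1 (c.eps d) with h1 | h1
  · exact (mul_nonpos_of_nonneg_of_nonpos hB.le (by linarith)).trans hS
  obtain ⟨m0, m1⟩ := pathLoad_nonneg hb ha0 m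
  have e1 := Psi_pathLoad_le hd hp hr hδ hb ha0 ha1 m
  have e2 := hm.trans (mixedNormTop_le_Psi hd hp hr hδ m0 m1)
  -- The choice of `δ` and `ε` gives `L / δ = (p + r) L / ε = ε B`.
  have e3 : Psi c.p c.r (c.delta d) (0 : ℝ × (Fin d → ℝ)) ≤ c.eps d * c.B := by
    refine (Psi_zero_le hr hδ).trans (le_of_eq ?_)
    rw [Params.delta]
    field_simp
    linarith
  have e4 : b * ((gradPsi c.p c.r (c.delta d) (pathLoad b a m)).1
      - (gradPsi c.p c.r (c.delta d) (0 : ℝ × (Fin d → ℝ))).1) ≤ onesNorm d c.p := by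
    have g1 := gradPsi_fst_le_one hd hp hr hδ m0 m1
    have g2 := (gradPsi_nonneg hd hp hr hδ (v := 0) le_rfl fun _ => le_rfl).1
    calc _ ≤ b * 1 := mul_le_mul_of_nonneg_left (by linarith) hb
      _ ≤ _ := by linarith
  have e5 : (1 + c.delta d) ^ (c.p + c.r - 2) ≤ Real.exp (c.eps d) := by
    calc _ ≤ (1 + c.delta d) ^ (c.p + c.r) :=
          Real.rpow_le_rpow_of_exponent_le (by linarith) (by linarith)
      _ ≤ Real.exp (c.delta d) ^ (c.p + c.r) :=
          Real.rpow_le_rpow (by linarith) (by linarith [Real.add_one_le_exp (c.delta d)]) hpr.le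
      _ = Real.exp (c.eps d) := by
          rw [← Real.exp_mul, Params.delta, div_mul_cancel₀ _ hpr.ne']
  have e6 : Real.exp (c.eps d) * (1 - c.eps d) ≤ 1 := by
    have := mul_le_mul_of_nonneg_left (Real.one_sub_le_exp_neg (c.eps d))
      (Real.exp_pos (c.eps d)).le
    rwa [← Real.exp_add, add_neg_cancel, Real.exp_zero] at this
  have e7 : c.B - c.eps d * c.B - onesNorm d c.p ≤ Real.exp (c.eps d) * S := by
    have := mul_le_mul_of_nonneg_right e5 hS
    linarith
  have e8 : (1 - c.eps d) * (c.B - c.eps d * c.B - onesNorm d c.p) ≤ S := by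
    have h2 := mul_le_mul_of_nonneg_left e7 (sub_nonneg.2 h1.le)
    have h3 := mul_le_mul_of_nonneg_right e6 hS
    linarith
  -- The quadratic term `ε² B` of `(1 - ε)² B` absorbs the additive loss `L` caused by the dummy
  -- resource.
  have e9 : onesNorm d c.p ≤ c.eps d ^ 2 * c.B := by
    rw [hε2]
    nlinarith
  nlinarith [mul_pos hε hL]

end

section

variable {n d k : ℕ} {i₀ : Fin n}

/-! ### Gains and costs -/

theorem sum_simplex (x : Simplex n) : ∑ i, (x : Fin n → ℝ) i = 1 := x.2.2

theorem dotProduct_simplex_le {y : Fin n → ℝ} {a : ℝ} (hy : ∀ i, y i ≤ a) (x : Simplex n) :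
    y ⬝ᵥ (x : Fin n → ℝ) ≤ a := by
  calc _ ≤ ∑ i, a * (x : Fin n → ℝ) i :=
        Finset.sum_le_sum fun i _ => mul_le_mul_of_nonneg_right (hy i) (x.2.1 i)
    _ = a := by rw [← Finset.mul_sum, sum_simplex, mul_one]

theorem dotProduct_simplex_nonneg {y : Fin n → ℝ} (hy : ∀ i, 0 ≤ y i) (x : Simplex n) :
    0 ≤ y ⬝ᵥ (x : Fin n → ℝ) :=
  Finset.sum_nonneg fun i _ => mul_nonneg (hy i) (x.2.1 i)

theorem gain_nonneg (w : Round n d i₀) (x : Simplex n) : 0 ≤ gain w x :=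
  dotProduct_simplex_nonneg (fun i => (w.2.1 i).1) x

theorem gain_le_one (w : Round n d i₀) (x : Simplex n) : gain w x ≤ 1 :=
  dotProduct_simplex_le (fun i => (w.2.1 i).2) x

theorem cost_nonneg (w : Round n d i₀) (x : Simplex n) (j : Fin d) : 0 ≤ cost w x j :=
  dotProduct_simplex_nonneg (fun i => (w.2.2.1 j i).1) x

theorem cost_le_one (w : Round n d i₀) (x : Simplex n) (j : Fin d) : cost w x j ≤ 1 :=
  dotProduct_simplex_le (fun i => (w.2.2.1 j i).2) x

theorem gain_pureAction (w : Round n d i₀) : gain w (pureAction i₀) = 0 := by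
  simp [gain, pureAction, w.2.2.2.1]

theorem cost_pureAction (w : Round n d i₀) : cost w (pureAction i₀) = 0 := by
  ext j
  simp [cost, pureAction, w.2.2.2.2 j]

/-- The round without rewards and costs. -/
def zeroRound : Round n d i₀ := ⟨(0, 0), by simp⟩

/-- The data of the rounds as a sequence over all natural numbers. -/
def dataAt {T : ℕ} (ω : Fin T → Round n d i₀) (t : ℕ) : Round n d i₀ :=
  if h : t < T then ω ⟨t, h⟩ else zeroRound

theorem dataAt_fin {T : ℕ} (ω : Fin T → Round n d i₀) (t : Fin T) : dataAt ω t = ω t := by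
  simp [dataAt]

/-! ### The surrogate problem as an adversary -/

/-- The range of parameters in which the surrogate rewards are bounded. -/
structure Params.Admissible (c : Params) (d : ℕ) : Prop where
  d_pos : 0 < d
  T_pos : 0 < c.T
  one_le_p : 1 ≤ c.p
  one_le_r : 1 ≤ c.r
  B_pos : 0 < c.B
  opt_nonneg : 0 ≤ c.opt
  opt_le : c.opt ≤ c.T

/-- The consumption of the dummy resource in every round. -/
def Params.rate (c : Params) : ℝ := c.B / c.T

namespace Params.Admissible

variable {c : Params} (hc : c.Admissible d)
include hc

theorem onesNorm_pos : 0 < onesNorm d c.p :=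
  BwK.onesNorm_pos hc.d_pos (zero_lt_one.trans_le hc.one_le_p)

theorem delta_pos : 0 < c.delta d := by
  have h1 := hc.one_le_p
  have h2 := hc.one_le_r
  have h3 := hc.onesNorm_pos
  have h4 := hc.B_pos
  have h5 : 0 < c.p + c.r := by linarith
  exact div_pos (Real.sqrt_pos.2 (by positivity)) h5

theorem lam_nonneg : 0 ≤ c.lam := div_nonneg hc.opt_nonneg hc.B_pos.le

theorem scale_pos : 0 < c.scale d :=
  add_pos_of_nonneg_of_pos (mul_nonneg hc.lam_nonneg hc.onesNorm_pos.le) one_pos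

theorem rate_pos : 0 < c.rate := div_pos hc.B_pos (Nat.cast_pos.2 hc.T_pos)

theorem T_mul_rate : c.T * c.rate = c.B :=
  mul_div_cancel₀ _ (Nat.cast_ne_zero.2 hc.T_pos.ne')

theorem lam_mul_rate : c.lam * c.rate = c.opt / c.T := by
  have := hc.B_pos.ne'
  have : (c.T : ℝ) ≠ 0 := Nat.cast_ne_zero.2 hc.T_pos.ne'
  rw [Params.lam, Params.rate]
  field_simp

theorem lam_mul_rate_le_one : c.lam * c.rate ≤ 1 := by
  rw [hc.lam_mul_rate]
  exact div_le_one_of_le₀ hc.opt_le (Nat.cast_nonneg _)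

theorem pairing_rate_nonneg {Λ : ℝ × (Fin d → ℝ)} (h0 : 0 ≤ Λ.1) (h1 : ∀ j, 0 ≤ Λ.2 j)
    {y : Fin d → ℝ} (hy0 : ∀ j, 0 ≤ y j) :
    0 ≤ pairing (c.rate, y) (gradPsi c.p c.r (c.delta d) Λ) := by
  obtain ⟨g0, g1⟩ := gradPsi_nonneg hc.d_pos hc.one_le_p hc.one_le_r hc.delta_pos h0 h1
  exact add_nonneg (mul_nonneg hc.rate_pos.le g0)
    (Finset.sum_nonneg fun j _ => mul_nonneg (hy0 j) (g1 j))

/-- The dummy resource costs at most `λ B / T = opt / T ≤ 1` and the real ones at most `λ L`; this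
is where the normalisation `λ L + 1` comes from. -/
theorem lam_mul_pairing_rate_le {Λ : ℝ × (Fin d → ℝ)} (h0 : 0 ≤ Λ.1) (h1 : ∀ j, 0 ≤ Λ.2 j)
    {y : Fin d → ℝ} (hy0 : ∀ j, 0 ≤ y j) (hy1 : ∀ j, y j ≤ 1) :
    c.lam * pairing (c.rate, y) (gradPsi c.p c.r (c.delta d) Λ) ≤ c.scale d := by
  have hp0 : 0 < c.p := zero_lt_one.trans_le hc.one_le_p
  have e1 := gradPsi_fst_le_one hc.d_pos hc.one_le_p hc.one_le_r hc.delta_pos h0 h1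
  have e2 := (dotProduct_gradPsi_snd_le hc.d_pos hc.one_le_p hc.one_le_r hc.delta_pos h0 h1
    hy0).trans (lpNorm_le_mul_onesNorm hp0 zero_le_one hy0 hy1)
  rw [one_mul] at e2
  have e3 := mul_le_mul_of_nonneg_left e1 (mul_nonneg hc.lam_nonneg hc.rate_pos.le)
  have e4 := mul_le_mul_of_nonneg_left e2 hc.lam_nonneg
  have e5 := hc.lam_mul_rate_le_one
  simp only [pairing, Params.scale, mul_add]
  linarith

theorem abs_lagrangianReward_le {Λ : ℝ × (Fin d → ℝ)} (h0 : 0 ≤ Λ.1) (h1 : ∀ j, 0 ≤ Λ.2 j)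
    (w : Round n d i₀) (i : Fin n) : |lagrangianReward c Λ w i| ≤ c.scale d := by
  rw [lagrangianReward]
  split_ifs
  · have e0 := hc.pairing_rate_nonneg h0 h1 fun j => (w.2.2.1 j i).1
    have e1 := hc.lam_mul_pairing_rate_le h0 h1 (fun j => (w.2.2.1 j i).1) fun j =>
      (w.2.2.1 j i).2
    have e2 := mul_nonneg hc.lam_nonneg e0
    have e3 : 1 ≤ c.scale d :=
      le_add_of_nonneg_left (mul_nonneg hc.lam_nonneg hc.onesNorm_pos.le)
    have e4 := w.2.1 i
    rw [Params.rate] at e1 e2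
    rw [abs_le]
    constructor <;> linarith [e4.1, e4.2]
  · simpa using hc.scale_pos.le

end Params.Admissible

open Classical in
theorem lagrangianReward_dotProduct (c : Params) (Λ : ℝ × (Fin d → ℝ)) (w : Round n d i₀)
    (x : Simplex n) : lagrangianReward c Λ w ⬝ᵥ (x : Fin n → ℝ) =
      if mixedNormTop c.p Λ ≤ c.B then
        gain w x - c.lam * pairing (c.rate, cost w x) (gradPsi c.p c.r (c.delta d) Λ)
      else 0 := by
  split_ifs with h
  · simp only [dotProduct, lagrangianReward, if_pos h, sub_mul, Finset.sum_sub_distrib, gain]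
    congr 1
    simp only [mul_assoc, ← Finset.mul_sum]
    congr 1
    simp only [pairing, add_mul, Finset.sum_add_distrib]
    congr 1
    · rw [← Finset.mul_sum, sum_simplex, mul_one, Params.rate]
    · simp only [dotProduct, cost, Matrix.mulVec, Finset.sum_mul]
      rw [Finset.sum_comm]
      exact Finset.sum_congr rfl fun i _ => Finset.sum_congr rfl fun j _ => by ring
  · simp [dotProduct, lagrangianReward, h]

/-- The load before round `t`, computed from the actions of the learner. -/
def loadOf (c : Params) (w : ℕ → Round n d i₀) {t : ℕ} (h : Fin t → Simplex n) :
    ℝ × (Fin d → ℝ) :=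
  (t * c.rate, ∑ j : Fin t, cost (w j) (h j))

theorem measurable_dotProduct {α : Type*} [MeasurableSpace α] {m : ℕ} {f g : α → Fin m → ℝ}
    (hf : Measurable f) (hg : Measurable g) : Measurable fun a => f a ⬝ᵥ g a :=
  Finset.measurable_sum _ fun i _ =>
    ((measurable_pi_apply i).comp hf).mul ((measurable_pi_apply i).comp hg)

theorem measurable_gain : Measurable fun q : Round n d i₀ × Simplex n => gain q.1 q.2 :=
  measurable_dotProduct (measurable_subtype_coe.comp measurable_fst).fst
    (measurable_subtype_coe.comp measurable_snd)

theorem measurable_cost : Measurable fun q : Round n d i₀ × Simplex n => cost q.1 q.2 :=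
  measurable_pi_lambda _ fun j => measurable_dotProduct
    (measurable_pi_lambda _ fun i => (measurable_matrix_entry j i).comp
      (measurable_subtype_coe.comp measurable_fst).snd)
    (measurable_subtype_coe.comp measurable_snd)

theorem measurable_mixedNormTop (p : ℝ) :
    Measurable (mixedNormTop p : ℝ × (Fin d → ℝ) → ℝ) := by
  unfold mixedNormTop lpNorm
  fun_prop

theorem measurable_pairing_gradPsi (p r δ : ℝ) :
    Measurable fun q : (ℝ × (Fin d → ℝ)) × (ℝ × (Fin d → ℝ)) =>
      pairing q.1 (gradPsi p r δ q.2) := by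
  have h : Measurable fun q : (ℝ × (Fin d → ℝ)) × (ℝ × (Fin d → ℝ)) => gradPsi p r δ q.2 :=
    (measurable_gradPsi p r δ).comp measurable_snd
  exact (measurable_fst.fst.mul h.fst).add (measurable_dotProduct measurable_fst.snd h.snd)

theorem measurable_lagrangianReward (c : Params) :
    Measurable fun q : (ℝ × (Fin d → ℝ)) × Round n d i₀ => lagrangianReward c q.1 q.2 := by
  refine measurable_pi_lambda _ fun i => ?_
  have hw : Measurable fun q : (ℝ × (Fin d → ℝ)) × Round n d i₀ => q.2.1 :=
    measurable_subtype_coe.comp measurable_snd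
  refine Measurable.ite (measurableSet_le ((measurable_mixedNormTop _).comp measurable_fst)
    measurable_const) ?_ measurable_const
  refine ((measurable_pi_apply i).comp hw.fst).sub
    (((measurable_pairing_gradPsi c.p c.r (c.delta d)).comp
      (Measurable.prodMk ?_ measurable_fst)).const_mul _)
  exact measurable_const.prodMk (measurable_pi_lambda _ fun j =>
    (measurable_matrix_entry j i).comp hw.snd)

/-- The adversary that presents the normalized surrogate rewards for the data `w`. -/
def surrogateAdversary (c : Params) (hc : c.Admissible d) (w : ℕ → Round n d i₀) :
    Adversary n where
  reward t h i := lagrangianReward c (loadOf c w h) (w t) i / c.scale d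
  measurable_reward t := by
    have h1 : Measurable fun h : Fin t → Simplex n => loadOf c w h :=
      measurable_const.prodMk (Finset.measurable_sum _ fun j _ =>
        measurable_cost.comp (measurable_const.prodMk (measurable_pi_apply j)))
    have h2 := (measurable_lagrangianReward c).comp (h1.prodMk (measurable_const (a := w t)))
    exact measurable_pi_lambda _ fun i => ((measurable_pi_apply i).comp h2).div_const _
  abs_reward_le t h i := by
    rw [abs_div, abs_of_pos hc.scale_pos]
    refine div_le_one_of_le₀ (hc.abs_lagrangianReward_le ?_ (fun j => ?_) _ _) hc.scale_pos.le
    · exact mul_nonneg (Nat.cast_nonneg _) hc.rate_pos.le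
    · simp only [loadOf, Finset.sum_apply]
      exact Finset.sum_nonneg fun _ _ => cost_nonneg _ _ _

/-! ### The run of a learner -/

section Learner

variable (F : Feedback n k) (A : OnlineAlgorithm n (Fin k → ℝ)) (adv : Adversary n) (s : A.Seed)

theorem learnerHistory_apply (t : ℕ) (i : Fin t) :
    learnerHistory F A adv s t i = (learnerAction F A adv s i,
      (F.M (learnerAction F A adv s i)).mulVec (adversaryReward F A adv s i)) := by
  induction t with
  | zero => exact i.elim0
  | succ t ih =>
    refine Fin.lastCases ?_ (fun i => ?_) i
    · simp [learnerAction, adversaryReward, learnerHistory]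
    · rw [learnerHistory]
      simpa using ih i

theorem adversaryReward_eq (t : ℕ) :
    adversaryReward F A adv s t = adv.reward t fun i => learnerAction F A adv s i := by
  rw [adversaryReward]
  congr 1
  funext i
  rw [learnerHistory_apply]

theorem learnerAction_eq (t : ℕ) :
    learnerAction F A adv s t = A.act t s fun i : Fin t =>
      (F.M (learnerAction F A adv s i)).mulVec (adversaryReward F A adv s i) := by
  rw [learnerAction, learnerHistory]
  simp [learnerHistory_apply]

end Learner

/-- The actions of the learner in the surrogate problem for the data `w`. -/
def surrogateAction (F : Feedback n k) (A : OnlineAlgorithm n (Fin k → ℝ)) (c : Params)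
    (hc : c.Admissible d) (w : ℕ → Round n d i₀) (s : A.Seed) (t : ℕ) : Simplex n :=
  learnerAction F A (surrogateAdversary c hc w) s t

/-- The load before round `t` of the surrogate problem for the data `w`. -/
def surrogateLoad (F : Feedback n k) (A : OnlineAlgorithm n (Fin k → ℝ)) (c : Params)
    (hc : c.Admissible d) (w : ℕ → Round n d i₀) (s : A.Seed) (t : ℕ) : ℝ × (Fin d → ℝ) :=
  pathLoad c.rate (fun i => cost (w i) (surrogateAction F A c hc w s i)) t

section Surrogate

variable (F : Feedback n k) (A : OnlineAlgorithm n (Fin k → ℝ)) {c : Params}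
  (hc : c.Admissible d) (w : ℕ → Round n d i₀) (s : A.Seed)

theorem adversaryReward_surrogate (t : ℕ) :
    adversaryReward F A (surrogateAdversary c hc w) s t = fun i =>
      lagrangianReward c (surrogateLoad F A c hc w s t) (w t) i / c.scale d := by
  rw [adversaryReward_eq]
  simp only [surrogateAdversary, surrogateLoad, loadOf, pathLoad, Finset.sum_range]
  rfl

theorem surrogateAction_eq (t : ℕ) :
    surrogateAction F A c hc w s t = A.act t s fun i : Fin t =>
      (F.M (surrogateAction F A c hc w s i)).mulVec fun a =>
        lagrangianReward c (surrogateLoad F A c hc w s i) (w i) a / c.scale d := by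
  rw [surrogateAction, learnerAction_eq]
  simp only [adversaryReward_surrogate]
  rfl

theorem surrogateLoad_nonneg (t : ℕ) : 0 ≤ (surrogateLoad F A c hc w s t).1 ∧
    ∀ j, 0 ≤ (surrogateLoad F A c hc w s t).2 j :=
  pathLoad_nonneg hc.rate_pos.le (fun _ => cost_nonneg _ _) t

theorem surrogateLoad_snd_mono {m t : ℕ} (h : m ≤ t) :
    lpNorm c.p (surrogateLoad F A c hc w s m).2 ≤ lpNorm c.p (surrogateLoad F A c hc w s t).2 := by
  refine lpNorm_mono (zero_lt_one.trans_le hc.one_le_p)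
    (surrogateLoad_nonneg F A hc w s m).2 fun j => ?_
  simp only [surrogateLoad, pathLoad, Finset.sum_apply]
  exact Finset.sum_le_sum_of_subset_of_nonneg (Finset.range_mono h) fun _ _ _ => cost_nonneg _ _ _

/-- The dummy load `t B / T` never exceeds `B` within the horizon, so the surrogate game closes
exactly when the real budget is exceeded. -/
theorem mixedNormTop_surrogateLoad_le_iff {t : ℕ} (ht : t ≤ c.T) :
    mixedNormTop c.p (surrogateLoad F A c hc w s t) ≤ c.B ↔
      lpNorm c.p (surrogateLoad F A c hc w s t).2 ≤ c.B := by
  rw [mixedNormTop, max_le_iff, and_iff_right_iff_imp]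
  intro
  rw [abs_of_nonneg (surrogateLoad_nonneg F A hc w s t).1, ← hc.T_mul_rate]
  exact mul_le_mul_of_nonneg_right (Nat.cast_le.2 ht) hc.rate_pos.le

/-- Causality of the run; it makes the load independent of the data of the current round. -/
theorem surrogateLoad_congr {w w' : ℕ → Round n d i₀} (t : ℕ) (h : ∀ i < t, w i = w' i) :
    surrogateLoad F A c hc w s t = surrogateLoad F A c hc w' s t ∧
      surrogateAction F A c hc w s t = surrogateAction F A c hc w' s t := by
  induction t using Nat.strong_induction_on with
  | _ t ih =>
    have ih' (i) (hi : i < t) := ih i hi fun j hj => h j (hj.trans hi)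
    constructor
    · simp only [surrogateLoad, pathLoad]
      rw [Finset.sum_congr rfl fun i hi => ?_]
      rw [(ih' i (Finset.mem_range.1 hi)).2, h i (Finset.mem_range.1 hi)]
    · rw [surrogateAction_eq, surrogateAction_eq]
      congr 1
      funext i
      rw [(ih' i i.2).1, (ih' i i.2).2, h i i.2]

end Surrogate

/-! ### The algorithm plays the actions of the learner until the budget is exceeded -/

open Classical in
theorem history_succ {T : ℕ} (F : Feedback n k) (p B : ℝ) (P : OnlineAlgorithm n (Obs n d k))
    (s : P.Seed) (ω : Fin T → Round n d i₀) (t : ℕ) (h : t + 1 ≤ T) :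
    history F p B P s ω (t + 1) h =
      Fin.snoc (α := fun _ => Simplex n × Round n d i₀)
        (history F p B P s ω t (Nat.le_of_succ_le h))
        (if lpNorm p (∑ i, cost (history F p B P s ω t (Nat.le_of_succ_le h) i).2
            (history F p B P s ω t (Nat.le_of_succ_le h) i).1) ≤ B
          then P.act t s fun i => observe F (history F p B P s ω t (Nat.le_of_succ_le h) i).1
            (history F p B P s ω t (Nat.le_of_succ_le h) i).2
          else pureAction i₀, ω ⟨t, h⟩) := by
  rw [history]

open Classical in
-- While the budget holds, the computed observations are those of the learner against the surrogate
-- adversary, so both runs coincide. Afterwards the learner's imaginary run continues while the real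
-- one is null; both must agree on when the budget is exceeded.
theorem history_lagrangianAlgorithm (F : Feedback n k) (A : OnlineAlgorithm n (Fin k → ℝ))
    {c : Params} (hc : c.Admissible d) (s : A.Seed) (ω : Fin c.T → Round n d i₀) (m : ℕ)
    (hm : m ≤ c.T) (i : Fin m) :
    history F c.p c.B (lagrangianAlgorithm d F A c) s ω m hm i =
      (if lpNorm c.p (surrogateLoad F A c hc (dataAt ω) s i).2 ≤ c.B
        then surrogateAction F A c hc (dataAt ω) s i else pureAction i₀, dataAt ω i) := by
  induction m with
  | zero => exact i.elim0
  | succ m ih =>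
    have ih' := ih (Nat.le_of_succ_le hm)
    rw [history_succ F c.p c.B (lagrangianAlgorithm d F A c) s ω m hm]
    refine Fin.lastCases ?_ (fun i => ?_) i
    swap
    · simpa using ih' i
    simp only [Fin.snoc_last, Fin.val_last]
    have hω : ω ⟨m, hm⟩ = dataAt ω m := by simp [dataAt, Nat.lt_of_succ_le hm]
    rw [hω]
    congr 1
    simp only [ih']
    by_cases hg : lpNorm c.p (surrogateLoad F A c hc (dataAt ω) s m).2 ≤ c.B
    · have hi (i : Fin m) : lpNorm c.p (surrogateLoad F A c hc (dataAt ω) s i).2 ≤ c.B :=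
        (surrogateLoad_snd_mono F A hc (dataAt ω) s i.2.le).trans hg
      simp only [hi, if_true, if_pos hg]
      have e : ∑ i : Fin m, cost (dataAt ω i) (surrogateAction F A c hc (dataAt ω) s i)
          = (surrogateLoad F A c hc (dataAt ω) s m).2 := by
        simp only [surrogateLoad, pathLoad, Finset.sum_range]
      rw [e, if_pos hg, surrogateAction_eq]
      change A.act m s _ = _
      congr 1
      funext i
      rw [surrogateObs_observe]
      congr 2
      have e2 : loadBefore c (fun i : Fin m => observe F
          (surrogateAction F A c hc (dataAt ω) s i) (dataAt ω i)) i
          = surrogateLoad F A c hc (dataAt ω) s i := by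
        simp only [loadBefore, surrogateLoad, pathLoad, observe, Params.rate]
        congr 1
        rw [← Nat.Iio_eq_range, ← Fin.map_valEmbedding_Iio, Finset.sum_map]
        rfl
      rw [e2]
    · rw [if_neg hg, if_neg]
      -- Before the first excess `l` the two runs agree, so the real cost after `m ≥ l` rounds
      -- dominates the surrogate load at `l` and exceeds the budget too.
      have hex : ∃ l, ¬ lpNorm c.p (surrogateLoad F A c hc (dataAt ω) s l).2 ≤ c.B := ⟨m, hg⟩
      have hl := Nat.find_spec hex
      have hlm : Nat.find hex ≤ m := Nat.find_min' hex hg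
      set l := Nat.find hex with hl_def
      refine fun h => hl (le_trans ?_ h)
      refine lpNorm_mono (zero_lt_one.trans_le hc.one_le_p)
        (surrogateLoad_nonneg F A hc _ s l).2 fun j => ?_
      have e := Finset.sum_range (n := m) fun i => cost (dataAt ω i)
        (if lpNorm c.p (surrogateLoad F A c hc (dataAt ω) s i).2 ≤ c.B
          then surrogateAction F A c hc (dataAt ω) s i else pureAction i₀)
      rw [← e, Finset.sum_apply]
      simp only [surrogateLoad, pathLoad, Finset.sum_apply]
      refine le_trans (Finset.sum_le_sum fun i hi => le_of_eq ?_)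
        (Finset.sum_le_sum_of_subset_of_nonneg (Finset.range_mono hlm)
          fun _ _ _ => cost_nonneg _ _ _)
      have := Nat.find_min hex (Finset.mem_range.1 hi)
      exact congrArg (fun x => cost (dataAt ω i) x j) (if_pos (not_not.1 this)).symm

open Classical in
theorem totalReward_lagrangianAlgorithm (F : Feedback n k) (A : OnlineAlgorithm n (Fin k → ℝ))
    {c : Params} (hc : c.Admissible d) (s : A.Seed) (ω : Fin c.T → Round n d i₀) :
    totalReward F c.p c.B (lagrangianAlgorithm d F A c) s ω = ∑ t ∈ Finset.range c.T,
      if mixedNormTop c.p (surrogateLoad F A c hc (dataAt ω) s t) ≤ c.B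
        then gain (dataAt ω t) (surrogateAction F A c hc (dataAt ω) s t) else 0 := by
  unfold totalReward
  rw [Finset.sum_range]
  refine Finset.sum_congr rfl fun t _ => ?_
  rw [history_lagrangianAlgorithm F A hc]
  simp only [mixedNormTop_surrogateLoad_le_iff F A hc (dataAt ω) s t.2.le]
  split_ifs
  · rfl
  · exact gain_pureAction _

attribute [irreducible] surrogateLoad surrogateAction

end

/-! ### Resampling one coordinate of an i.i.d. sequence -/

section Resample

variable {X : Type*} [MeasurableSpace X] {T : ℕ} (μ : Measure X) [IsProbabilityMeasure μ]

theorem measurePreserving_update (t : Fin T) :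
    MeasurePreserving (fun q : (Fin T → X) × X => Function.update q.1 t q.2)
      ((Measure.pi fun _ => μ).prod μ) (Measure.pi fun _ => μ) := by
  have hm : Measurable fun q : (Fin T → X) × X => Function.update q.1 t q.2 :=
    measurable_update'
  refine ⟨hm, (Measure.pi_eq fun S hS => ?_).symm⟩
  rw [Measure.map_apply hm (MeasurableSet.univ_pi hS)]
  have e : (fun q : (Fin T → X) × X => Function.update q.1 t q.2) ⁻¹' Set.univ.pi S
      = (Set.univ.pi (Function.update S t Set.univ)) ×ˢ S t := by
    ext q
    simp only [Set.mem_preimage, Set.mem_pi, Set.mem_univ, true_imp_iff, Set.mem_prod]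
    constructor
    · refine fun h => ⟨fun i => ?_, by simpa using h t⟩
      rcases eq_or_ne i t with rfl | hi
      · simp
      · simpa [hi] using h i
    · rintro ⟨h1, h2⟩ i
      rcases eq_or_ne i t with rfl | hi
      · simpa using h2
      · simpa [hi] using h1 i
  rw [e, Measure.prod_prod, Measure.pi_pi, ← Finset.mul_prod_erase _ _ (Finset.mem_univ t),
    ← Finset.mul_prod_erase _ (fun i => μ (S i)) (Finset.mem_univ t)]
  simp only [Function.update_self, measure_univ, one_mul]
  rw [mul_comm]
  congr 1
  refine Finset.prod_congr rfl fun i hi => ?_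
  rw [Function.update_of_ne (Finset.ne_of_mem_erase hi)]

theorem integrable_of_abs_le {Y : Type*} [MeasurableSpace Y] {ν : Measure Y} [IsFiniteMeasure ν]
    {f : Y → ℝ} (hf : Measurable f) {K : ℝ} (hK : ∀ y, |f y| ≤ K) : Integrable f ν :=
  Integrable.of_bound hf.aestronglyMeasurable K (Filter.Eventually.of_forall hK)

/-- Independence in the form needed: coordinate `t` may be replaced by a fresh sample if `f` depends
on the sequence only through the other coordinates. -/
theorem integral_resample (t : Fin T) {f : (Fin T → X) → X → ℝ}
    (hf : Measurable fun q : (Fin T → X) × X => f q.1 q.2) {K : ℝ} (hK : ∀ ω w, |f ω w| ≤ K)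
    (hind : ∀ ω w v, f (Function.update ω t w) v = f ω v) :
    ∫ ω, f ω (ω t) ∂(Measure.pi fun _ => μ) = ∫ ω, ∫ w, f ω w ∂μ ∂(Measure.pi fun _ => μ) := by
  have hm := measurePreserving_update (T := T) μ t
  have hf' : Measurable fun ω : Fin T → X => f ω (ω t) :=
    hf.comp (measurable_id.prodMk (measurable_pi_apply t))
  rw [← integral_prod (fun q : (Fin T → X) × X => f q.1 q.2)
    (integrable_of_abs_le hf fun q => hK q.1 q.2), ← hm.map_eq,
    integral_map hm.measurable.aemeasurable hf'.aestronglyMeasurable, hm.map_eq]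
  simp [hind]

end Resample

variable {n d k : ℕ} {i₀ : Fin n}

theorem measurable_dataAt {T : ℕ} (t : ℕ) :
    Measurable fun ω : Fin T → Round n d i₀ => dataAt ω t := by
  unfold dataAt
  split_ifs with h
  · exact measurable_pi_apply _
  · exact measurable_const

/-! ### Measurability of the run and regret on random data -/

section Run

variable (F : Feedback n k) (A : OnlineAlgorithm n (Fin k → ℝ)) {c : Params}
  (hc : c.Admissible d)

theorem measurable_mulVec {α : Type*} [MeasurableSpace α] {M : α → Matrix (Fin k) (Fin n) ℝ}
    {v : α → Fin n → ℝ} (hM : Measurable M) (hv : Measurable v) :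
    Measurable fun a => (M a).mulVec (v a) :=
  measurable_pi_lambda _ fun j => measurable_dotProduct
    (measurable_pi_lambda _ fun i => (measurable_matrix_entry j i).comp hM) hv

theorem measurable_surrogateLoad_surrogateAction (t : ℕ) :
    (Measurable fun q : A.Seed × (Fin c.T → Round n d i₀) =>
      surrogateLoad F A c hc (dataAt q.2) q.1 t) ∧
    Measurable fun q : A.Seed × (Fin c.T → Round n d i₀) =>
      surrogateAction F A c hc (dataAt q.2) q.1 t := by
  induction t using Nat.strong_induction_on with
  | _ t ih =>
    constructor
    · unfold surrogateLoad
      refine measurable_const.prodMk (Finset.measurable_sum _ fun i hi => ?_)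
      exact measurable_cost.comp (((measurable_dataAt i).comp measurable_snd).prodMk
        (ih i (Finset.mem_range.1 hi)).2)
    · simp only [surrogateAction_eq F A hc _ _ t]
      refine (A.measurable_act t).comp (measurable_fst.prodMk (measurable_pi_lambda _ fun i => ?_))
      refine measurable_mulVec (F.measurable_M.comp (ih i i.2).2) ?_
      refine measurable_pi_lambda _ fun a => Measurable.div_const ?_ _
      exact (measurable_pi_apply a).comp ((measurable_lagrangianReward c).comp
        ((ih i i.2).1.prodMk ((measurable_dataAt i).comp measurable_snd)))

theorem measurable_lagrangianReward_dotProduct (t : ℕ)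
    {x : A.Seed × (Fin c.T → Round n d i₀) → Simplex n} (hx : Measurable x) :
    Measurable fun q : A.Seed × (Fin c.T → Round n d i₀) =>
      lagrangianReward c (surrogateLoad F A c hc (dataAt q.2) q.1 t) (dataAt q.2 t)
        ⬝ᵥ (x q : Fin n → ℝ) :=
  measurable_dotProduct ((measurable_lagrangianReward c).comp
    ((measurable_surrogateLoad_surrogateAction F A hc t).1.prodMk
      ((measurable_dataAt t).comp measurable_snd))) (measurable_subtype_coe.comp hx)

theorem Params.Admissible.abs_lagrangianReward_dotProduct_le {c : Params} (hc : c.Admissible d)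
    {Λ : ℝ × (Fin d → ℝ)} (h0 : 0 ≤ Λ.1) (h1 : ∀ j, 0 ≤ Λ.2 j) (w : Round n d i₀)
    (x : Simplex n) : |lagrangianReward c Λ w ⬝ᵥ (x : Fin n → ℝ)| ≤ c.scale d := by
  have h (i) := abs_le.1 (hc.abs_lagrangianReward_le h0 h1 w i)
  rw [abs_le]
  refine ⟨?_, dotProduct_simplex_le (fun i => (h i).2) x⟩
  have := dotProduct_simplex_le (y := -lagrangianReward c Λ w) (a := c.scale d)
    (fun i => by have := (h i).1; simp only [Pi.neg_apply]; linarith) x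
  rw [neg_dotProduct] at this
  linarith

variable (μ : Measure (Round n d i₀)) [IsProbabilityMeasure μ]

theorem integrable_lagrangianReward_dotProduct (t : ℕ)
    {x : A.Seed × (Fin c.T → Round n d i₀) → Simplex n} (hx : Measurable x) :
    Integrable (fun q : A.Seed × (Fin c.T → Round n d i₀) =>
      lagrangianReward c (surrogateLoad F A c hc (dataAt q.2) q.1 t) (dataAt q.2 t)
        ⬝ᵥ (x q : Fin n → ℝ)) (A.law.prod (Measure.pi fun _ => μ)) :=
  integrable_of_abs_le (measurable_lagrangianReward_dotProduct F A hc t hx) fun _ =>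
    hc.abs_lagrangianReward_dotProduct_le (surrogateLoad_nonneg F A hc _ _ t).1
      (surrogateLoad_nonneg F A hc _ _ t).2 _ _

/-- The regret bound of the learner in the surrogate problem with random data. -/
theorem integral_surrogate_regret_le {ρ : ℝ} (hρ : HasRegretBound F A c.T ρ) (x : Simplex n) :
    ∫ q : A.Seed × (Fin c.T → Round n d i₀), ∑ t ∈ Finset.range c.T,
      (lagrangianReward c (surrogateLoad F A c hc (dataAt q.2) q.1 t) (dataAt q.2 t)
          ⬝ᵥ (x : Fin n → ℝ)
        - lagrangianReward c (surrogateLoad F A c hc (dataAt q.2) q.1 t) (dataAt q.2 t)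
          ⬝ᵥ (surrogateAction F A c hc (dataAt q.2) q.1 t : Fin n → ℝ))
      ∂(A.law.prod (Measure.pi fun _ => μ)) ≤ c.scale d * ρ := by
  have hs := hc.scale_pos
  have hI := integrable_finsetSum (Finset.range c.T) fun t _ =>
    (integrable_lagrangianReward_dotProduct F A hc μ t (measurable_const (a := x))).sub
      (integrable_lagrangianReward_dotProduct F A hc μ t
        (measurable_surrogateLoad_surrogateAction F A hc t).2)
  simp only [Pi.sub_apply] at hI
  -- The seed is integrated first: for each fixed data sequence the adversary is legitimate, and the
  -- regret bound is uniform in the data.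
  rw [integral_prod_symm _ hI]
  have h (ω : Fin c.T → Round n d i₀) : ∫ s, ∑ t ∈ Finset.range c.T,
      (lagrangianReward c (surrogateLoad F A c hc (dataAt ω) s t) (dataAt ω t)
          ⬝ᵥ (x : Fin n → ℝ)
        - lagrangianReward c (surrogateLoad F A c hc (dataAt ω) s t) (dataAt ω t)
          ⬝ᵥ (surrogateAction F A c hc (dataAt ω) s t : Fin n → ℝ)) ∂A.law ≤ c.scale d * ρ := by
    have e := hρ (surrogateAdversary c hc (dataAt ω)) x
    have e2 (Λ : ℝ × (Fin d → ℝ)) (w : Round n d i₀) :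
        (fun i => lagrangianReward c Λ w i / c.scale d)
          = (c.scale d)⁻¹ • lagrangianReward c Λ w := by
      ext i
      simp [div_eq_inv_mul]
    simp only [adversaryReward_surrogate, ← surrogateAction.eq_def, e2, smul_dotProduct, smul_eq_mul, ← mul_sub,
      ← Finset.mul_sum] at e
    rw [integral_const_mul, inv_mul_le_iff₀ hs] at e
    exact e
  refine (integral_mono hI.integral_prod_right (integrable_const _) h).trans ?_
  simp

end Run

section

variable {n d k : ℕ} {i₀ : Fin n}

/-! ### A fixed distribution in the surrogate game -/

section Comparator

variable (F : Feedback n k) (A : OnlineAlgorithm n (Fin k → ℝ)) {c : Params}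
  (hc : c.Admissible d) (μ : Measure (Round n d i₀))

/-- The expected reward of `x` in one round. -/
def meanGain (μ : Measure (Round n d i₀)) (x : Simplex n) : ℝ := ∫ w, gain w x ∂μ

/-- The expected cost of `x` in one round. -/
def meanCost (μ : Measure (Round n d i₀)) (x : Simplex n) : Fin d → ℝ :=
  fun j => ∫ w, cost w x j ∂μ

theorem meanGain_nonneg (x : Simplex n) : 0 ≤ meanGain μ x :=
  integral_nonneg fun w => gain_nonneg w x

theorem meanCost_nonneg (x : Simplex n) (j : Fin d) : 0 ≤ meanCost μ x j :=
  integral_nonneg fun w => cost_nonneg w x j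

theorem totalReward_nonneg {T : ℕ} (p B : ℝ) (P : OnlineAlgorithm n (Obs n d k)) (s : P.Seed)
    (ω : Fin T → Round n d i₀) : 0 ≤ totalReward F p B P s ω :=
  Finset.sum_nonneg fun _ _ => gain_nonneg _ _

theorem totalReward_le {T : ℕ} (p B : ℝ) (P : OnlineAlgorithm n (Obs n d k)) (s : P.Seed)
    (ω : Fin T → Round n d i₀) : totalReward F p B P s ω ≤ T := by
  have h := Finset.sum_le_sum (s := Finset.univ) fun (i : Fin T) _ =>
    gain_le_one (history F p B P s ω T le_rfl i).2 (history F p B P s ω T le_rfl i).1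
  rw [Finset.sum_const, Finset.card_univ, Fintype.card_fin, nsmul_eq_mul, mul_one] at h
  exact h

theorem expectedReward_nonneg (T : ℕ) (p B : ℝ) (P : OnlineAlgorithm n (Obs n d k)) :
    0 ≤ expectedReward T F p B P μ :=
  integral_nonneg fun q => totalReward_nonneg F p B P q.1 q.2

variable [IsProbabilityMeasure μ]

theorem integrable_gain (x : Simplex n) : Integrable (fun w => gain w x) μ :=
  integrable_of_abs_le (measurable_gain.comp (measurable_id.prodMk measurable_const)) fun w =>
    (abs_of_nonneg (gain_nonneg w x)).trans_le (gain_le_one w x)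

theorem integrable_cost (x : Simplex n) (j : Fin d) : Integrable (fun w => cost w x j) μ :=
  integrable_of_abs_le ((measurable_pi_apply j).comp
      (measurable_cost.comp (measurable_id.prodMk measurable_const))) fun w =>
    (abs_of_nonneg (cost_nonneg w x j)).trans_le (cost_le_one w x j)

theorem meanGain_le_one (x : Simplex n) : meanGain μ x ≤ 1 := by
  have h := integral_mono (integrable_gain μ x) (integrable_const 1) fun w => gain_le_one w x
  rw [integral_const, probReal_univ, one_smul] at h
  exact h

open Classical in
/-- The number of rounds before the budget is exceeded. -/
def openRounds (w : ℕ → Round n d i₀) (s : A.Seed) : ℝ :=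
  ∑ t ∈ Finset.range c.T,
    if mixedNormTop c.p (surrogateLoad F A c hc w s t) ≤ c.B then (1 : ℝ) else 0

theorem measurableSet_open (t : ℕ) :
    MeasurableSet {q : A.Seed × (Fin c.T → Round n d i₀) |
      mixedNormTop c.p (surrogateLoad F A c hc (dataAt q.2) q.1 t) ≤ c.B} :=
  measurableSet_le ((measurable_mixedNormTop c.p).comp
    (measurable_surrogateLoad_surrogateAction F A hc t).1) measurable_const

include hc in
-- With the load frozen, the expectation passes inside the linear pairing, and Hölder bounds the
-- price of the mean cost uniformly in the load.
theorem integral_lagrangianReward_dotProduct_ge {Λ : ℝ × (Fin d → ℝ)} (h0 : 0 ≤ Λ.1)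
    (h1 : ∀ j, 0 ≤ Λ.2 j) (x : Simplex n) (hΛ : mixedNormTop c.p Λ ≤ c.B) :
    meanGain μ x - c.lam * mixedNorm c.p c.r (c.rate, meanCost μ x)
      ≤ ∫ w, lagrangianReward c Λ w ⬝ᵥ (x : Fin n → ℝ) ∂μ := by
  have hC (j) := integrable_cost μ x j
  have hP := integrable_finsetSum Finset.univ fun j _ =>
    (hC j).mul_const ((gradPsi c.p c.r (c.delta d) Λ).2 j)
  have e : ∫ w, lagrangianReward c Λ w ⬝ᵥ (x : Fin n → ℝ) ∂μ
      = meanGain μ x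
        - c.lam * pairing (c.rate, meanCost μ x) (gradPsi c.p c.r (c.delta d) Λ) := by
    simp only [lagrangianReward_dotProduct, if_pos hΛ]
    simp only [pairing, dotProduct]
    have hQ : Integrable (fun w : Round n d i₀ => c.lam * (c.rate * (gradPsi c.p c.r (c.delta d) Λ).1
        + ∑ j, cost w x j * (gradPsi c.p c.r (c.delta d) Λ).2 j)) μ :=
      ((integrable_const _).add hP).const_mul _
    rw [integral_sub (integrable_gain μ x) hQ,
      integral_const_mul, integral_add (integrable_const _) hP,
      integral_finsetSum _ fun j _ => (hC j).mul_const _]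
    simp only [integral_mul_const, integral_const, probReal_univ, one_smul, meanGain, meanCost]
  rw [e]
  have := mul_le_mul_of_nonneg_left (pairing_gradPsi_le hc.d_pos hc.one_le_p hc.one_le_r
    hc.delta_pos h0 h1 (w := (c.rate, meanCost μ x)) hc.rate_pos.le (meanCost_nonneg μ x))
    hc.lam_nonneg
  linarith

theorem integrable_openRounds : Integrable (fun q : A.Seed × (Fin c.T → Round n d i₀) =>
    openRounds F A hc (dataAt q.2) q.1) (A.law.prod (Measure.pi fun _ => μ)) :=
  integrable_finsetSum _ fun t _ => integrable_of_abs_le (K := 1)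
    (Measurable.ite (measurableSet_open F A hc t) measurable_const measurable_const) fun q => by
      split_ifs <;> simp

open Classical in
-- For a fixed seed, the load and hence the event that the round is open depend only on earlier
-- data, so the current data can be resampled. In a closed round both sides vanish.
theorem integral_openRound_le (x : Simplex n) (s : A.Seed) (t : Fin c.T) :
    ∫ ω : Fin c.T → Round n d i₀,
      (if mixedNormTop c.p (surrogateLoad F A c hc (dataAt ω) s t) ≤ c.B then
        meanGain μ x - c.lam * mixedNorm c.p c.r (c.rate, meanCost μ x) else 0)
      ∂(Measure.pi fun _ => μ)
    ≤ ∫ ω : Fin c.T → Round n d i₀,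
      lagrangianReward c (surrogateLoad F A c hc (dataAt ω) s t) (dataAt ω t)
        ⬝ᵥ (x : Fin n → ℝ) ∂(Measure.pi fun _ => μ) := by
  set K := meanGain μ x - c.lam * mixedNorm c.p c.r (c.rate, meanCost μ x) with hK
  have hload (ω : Fin c.T → Round n d i₀) (w : Round n d i₀) :
      surrogateLoad F A c hc (dataAt (Function.update ω t w)) s t
        = surrogateLoad F A c hc (dataAt ω) s t :=
    (surrogateLoad_congr F A hc s t fun i hi => by
      have h : (⟨i, hi.trans t.2⟩ : Fin c.T) ≠ t := fun h => hi.ne (congrArg Fin.val h)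
      simp [dataAt, hi.trans t.2, h]).1
  have hloadm : Measurable fun ω : Fin c.T → Round n d i₀ =>
      surrogateLoad F A c hc (dataAt ω) s t :=
    (measurable_surrogateLoad_surrogateAction (i₀ := i₀) F A hc t).1.comp
      (measurable_prodMk_left (x := s) (β := Fin c.T → Round n d i₀))
  have hm : Measurable fun q : (Fin c.T → Round n d i₀) × Round n d i₀ =>
      lagrangianReward c (surrogateLoad F A c hc (dataAt q.1) s t) q.2 ⬝ᵥ (x : Fin n → ℝ) :=
    measurable_dotProduct ((measurable_lagrangianReward c).comp
      ((hloadm.comp measurable_fst).prodMk measurable_snd)) measurable_const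
  have hbd (ω : Fin c.T → Round n d i₀) (w : Round n d i₀) :=
    hc.abs_lagrangianReward_dotProduct_le (surrogateLoad_nonneg F A hc (dataAt ω) s t).1
      (surrogateLoad_nonneg F A hc (dataAt ω) s t).2 w x
  have e := integral_resample μ t (f := fun ω w =>
    lagrangianReward c (surrogateLoad F A c hc (dataAt ω) s t) w ⬝ᵥ (x : Fin n → ℝ)) hm hbd
    (fun ω w v => by simp only [hload])
  simp only [dataAt_fin]
  rw [e]
  refine integral_mono ?_ (integrable_of_abs_le (K := c.scale d) ?_ ?_) fun ω => ?_
  · refine integrable_of_abs_le (K := |K|) (Measurable.ite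
      (measurableSet_le ((measurable_mixedNormTop c.p).comp hloadm) measurable_const)
      measurable_const measurable_const) fun q => ?_
    split_ifs <;> simp
  · exact hm.stronglyMeasurable.integral_prod_right.measurable
  · intro ω
    have := norm_integral_le_of_norm_le_const (μ := μ) (C := c.scale d)
      (Filter.Eventually.of_forall fun w => (Real.norm_eq_abs _).trans_le (hbd ω w))
    rwa [probReal_univ, mul_one] at this
  · dsimp only
    obtain ⟨h0, h1⟩ := surrogateLoad_nonneg F A hc (dataAt ω) s t
    split_ifs with h
    · exact integral_lagrangianReward_dotProduct_ge hc μ h0 h1 x h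
    · simp only [lagrangianReward_dotProduct, if_neg h, integral_zero, le_refl]

theorem comparator_le (x : Simplex n) :
    (meanGain μ x - c.lam * mixedNorm c.p c.r (c.rate, meanCost μ x))
      * ∫ q : A.Seed × (Fin c.T → Round n d i₀), openRounds F A hc (dataAt q.2) q.1
        ∂(A.law.prod (Measure.pi fun _ => μ))
      ≤ ∫ q : A.Seed × (Fin c.T → Round n d i₀), ∑ t ∈ Finset.range c.T,
        lagrangianReward c (surrogateLoad F A c hc (dataAt q.2) q.1 t) (dataAt q.2 t)
          ⬝ᵥ (x : Fin n → ℝ) ∂(A.law.prod (Measure.pi fun _ => μ)) := by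
  classical
  have hI (t : ℕ) := integrable_lagrangianReward_dotProduct F A hc μ t (measurable_const (a := x))
  have hG (K : ℝ) (t : ℕ) : Integrable (fun q : A.Seed × (Fin c.T → Round n d i₀) =>
      if mixedNormTop c.p (surrogateLoad F A c hc (dataAt q.2) q.1 t) ≤ c.B then K else 0)
      (A.law.prod (Measure.pi fun _ => μ)) :=
    integrable_of_abs_le (K := |K|)
      (Measurable.ite (measurableSet_open F A hc t) measurable_const measurable_const) fun q => by
        split_ifs <;> simp
  rw [← integral_const_mul, integral_finsetSum _ fun t _ => hI t]
  simp only [openRounds, Finset.mul_sum, mul_ite, mul_one, mul_zero]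
  rw [integral_finsetSum _ fun t _ => hG _ t]
  refine Finset.sum_le_sum fun t ht => ?_
  rw [integral_prod _ (hI t), integral_prod _ (hG _ t)]
  exact integral_mono (hG _ t).integral_prod_left (hI t).integral_prod_left fun s =>
    integral_openRound_le F A hc μ x s ⟨t, Finset.mem_range.1 ht⟩

/-! ### From the surrogate problem to the collected reward -/

include hc in
theorem measurable_totalReward :
    Measurable fun q : A.Seed × (Fin c.T → Round n d i₀) =>
      totalReward F c.p c.B (lagrangianAlgorithm d F A c) q.1 q.2 := by
  classical
  simp only [totalReward_lagrangianAlgorithm F A hc]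
  refine Finset.measurable_sum _ fun t _ =>
    Measurable.ite (measurableSet_open F A hc t) ?_ measurable_const
  exact measurable_gain.comp (((measurable_dataAt t).comp measurable_snd).prodMk
    (measurable_surrogateLoad_surrogateAction F A hc t).2)

/-- A pathwise lower bound `κ` for the price that is paid yields a lower bound for the reward. -/
theorem comparator_add_le_expectedReward {ρ : ℝ} (hρ : HasRegretBound F A c.T ρ) (x : Simplex n)
    {κ : ℝ} (hκ : ∀ (s : A.Seed) (ω : Fin c.T → Round n d i₀),
      ∑ t ∈ Finset.range c.T, lagrangianReward c (surrogateLoad F A c hc (dataAt ω) s t)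
        (dataAt ω t) ⬝ᵥ (surrogateAction F A c hc (dataAt ω) s t : Fin n → ℝ) + κ
      ≤ totalReward F c.p c.B (lagrangianAlgorithm d F A c) s ω) :
    (meanGain μ x - c.lam * mixedNorm c.p c.r (c.rate, meanCost μ x))
      * (∫ q : A.Seed × (Fin c.T → Round n d i₀), openRounds F A hc (dataAt q.2) q.1
        ∂(A.law.prod (Measure.pi fun _ => μ))) + κ - c.scale d * ρ
      ≤ expectedReward c.T F c.p c.B (lagrangianAlgorithm d F A c) μ := by
  have h1 := comparator_le F A hc μ x
  have h2 := integral_surrogate_regret_le F A hc μ hρ x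
  have hI1 := integrable_finsetSum (Finset.range c.T) fun t _ =>
    integrable_lagrangianReward_dotProduct F A hc μ t (measurable_const (a := x))
  have hI2 := integrable_finsetSum (Finset.range c.T) fun t _ =>
    integrable_lagrangianReward_dotProduct F A hc μ t
      (measurable_surrogateLoad_surrogateAction F A hc t).2
  simp only [Finset.sum_sub_distrib] at h2
  rw [integral_sub hI1 hI2] at h2
  have hT : Integrable (fun q : A.Seed × (Fin c.T → Round n d i₀) =>
      totalReward F c.p c.B (lagrangianAlgorithm d F A c) q.1 q.2)
      (A.law.prod (Measure.pi fun _ => μ)) :=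
    integrable_of_abs_le (measurable_totalReward F A hc) fun q =>
      (abs_of_nonneg (totalReward_nonneg F c.p c.B (lagrangianAlgorithm d F A c) q.1 q.2)).trans_le
        (totalReward_le F c.p c.B (lagrangianAlgorithm d F A c) q.1 q.2)
  have h3 := integral_mono (hI2.add (integrable_const κ)) hT fun q => hκ q.1 q.2
  simp only [Pi.add_apply] at h3
  rw [integral_add hI2 (integrable_const κ)] at h3
  simp only [integral_const, probReal_univ, one_smul] at h3
  have h4 : expectedReward c.T F c.p c.B (lagrangianAlgorithm d F A c) μ
      = ∫ q : A.Seed × (Fin c.T → Round n d i₀),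
        totalReward F c.p c.B (lagrangianAlgorithm d F A c) q.1 q.2
        ∂(A.law.prod (Measure.pi fun _ => μ)) := rfl
  rw [h4]
  linarith

end Comparator

end

section

variable {n d k : ℕ} {i₀ : Fin n}

/-! ### The benchmark -/

section Benchmark

variable (T : ℕ) (p B : ℝ) (μ : Measure (Round n d i₀))

theorem benchmarkTime_le (x : Simplex n) : benchmarkTime T p B μ x ≤ T :=
  Nat.findGreatest_le T

/-- Lets a bound uniform in `x` pass to the supremum, so that no maximiser is needed. -/
theorem mul_OPT_le {p B a K : ℝ} (ha : 0 ≤ a) (h : ∀ x, a * benchmarkReward T p B μ x ≤ K) :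
    a * OPT T p B μ ≤ K := by
  have : Nonempty (Simplex n) := ⟨pureAction i₀⟩
  rw [OPT, Real.mul_iSup_of_nonneg ha]
  exact ciSup_le h

variable [IsProbabilityMeasure μ]

theorem integral_sum_lt_eval {m : ℕ} (hm : m ≤ T) {f : Round n d i₀ → ℝ} (hf : Integrable f μ) :
    ∫ ω : Fin T → Round n d i₀, ∑ t with t.val < m, f (ω t) ∂(Measure.pi fun _ => μ)
      = m * ∫ w, f w ∂μ := by
  have h (t : Fin T) := measurePreserving_eval (fun _ : Fin T => μ) t
  have e (t : Fin T) : ∫ ω : Fin T → Round n d i₀, f (ω t) ∂(Measure.pi fun _ => μ)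
      = ∫ w, f w ∂μ := by
    have h1 := integral_map (φ := Function.eval t) (h t).measurable.aemeasurable (f := f)
      (by rw [(h t).map_eq]; exact hf.aestronglyMeasurable)
    rw [(h t).map_eq] at h1
    exact h1.symm
  have hI (t : Fin T) : Integrable (fun ω : Fin T → Round n d i₀ => f (ω t))
      (Measure.pi fun _ => μ) := (h t).integrable_comp_of_integrable hf
  rw [integral_finsetSum _ fun t _ => hI t]
  simp only [e, Finset.sum_const, nsmul_eq_mul, Fin.card_filter_val_lt, min_eq_right hm]

theorem benchmarkLoad_eq {m : ℕ} (hm : m ≤ T) (x : Simplex n) :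
    benchmarkLoad T μ x m = fun j => m * meanCost μ x j :=
  funext fun j => integral_sum_lt_eval T μ hm (integrable_cost μ x j)

theorem benchmarkReward_eq (x : Simplex n) :
    benchmarkReward T p B μ x = benchmarkTime T p B μ x * meanGain μ x :=
  integral_sum_lt_eval T μ (benchmarkTime_le T p B μ x) (integrable_gain μ x)

variable {p B}

theorem lpNorm_benchmarkTime_le (hp : 0 < p) (hB : 0 < B) (x : Simplex n) :
    lpNorm p (fun j => (benchmarkTime T p B μ x : ℝ) * meanCost μ x j) ≤ B := by
  classical
  rw [← benchmarkLoad_eq T μ (benchmarkTime_le T p B μ x)]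
  -- The witness `m = 0` has zero load, so the stopping time really satisfies the budget constraint
  -- and is not just the default value.
  refine Nat.findGreatest_spec (P := fun m => lpNorm p (benchmarkLoad T μ x m) ≤ B)
    (Nat.zero_le T) ?_
  have e : benchmarkLoad T μ x 0 = 0 := by
    rw [benchmarkLoad_eq T μ (Nat.zero_le T)]
    simp
    rfl
  rw [e, lpNorm_zero hp]
  exact hB.le

/-- The mixture of `x` with the null action that plays `x` with probability `θ`. -/
def dilute (i₀ : Fin n) (x : Simplex n) {θ : ℝ} (h0 : 0 ≤ θ) (h1 : θ ≤ 1) : Simplex n :=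
  ⟨θ • (x : Fin n → ℝ) + (1 - θ) • (pureAction i₀ : Fin n → ℝ),
    convex_stdSimplex ℝ (Fin n) x.2 (pureAction i₀).2 h0 (sub_nonneg.2 h1)
      (add_sub_cancel _ _)⟩

theorem gain_dilute (w : Round n d i₀) (x : Simplex n) {θ : ℝ} (h0 : 0 ≤ θ) (h1 : θ ≤ 1) :
    gain w (dilute i₀ x h0 h1) = θ * gain w x := by
  have h := gain_pureAction w
  unfold gain at h ⊢
  change w.1.1 ⬝ᵥ (θ • (x : Fin n → ℝ) + (1 - θ) • (pureAction i₀ : Fin n → ℝ)) = _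
  rw [dotProduct_add, dotProduct_smul, dotProduct_smul, h, smul_zero, add_zero, smul_eq_mul]

theorem cost_dilute (w : Round n d i₀) (x : Simplex n) {θ : ℝ} (h0 : 0 ≤ θ) (h1 : θ ≤ 1) :
    cost w (dilute i₀ x h0 h1) = θ • cost w x := by
  have h := cost_pureAction w
  unfold cost at h ⊢
  change w.1.2.mulVec (θ • (x : Fin n → ℝ) + (1 - θ) • (pureAction i₀ : Fin n → ℝ)) = _
  rw [Matrix.mulVec_add, Matrix.mulVec_smul, Matrix.mulVec_smul, h, smul_zero, add_zero]

/-- A distribution whose expected cost fits into the budget for all `T` rounds and whose expected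
total reward is that of the benchmark. -/
theorem exists_meanGain_eq (hT : 0 < T) (hp : 0 < p) (hB : 0 < B) (x : Simplex n) :
    ∃ y : Simplex n, T * meanGain μ y = benchmarkReward T p B μ x ∧
      lpNorm p (meanCost μ y) ≤ B / T := by
  have hT' : (0 : ℝ) < T := Nat.cast_pos.2 hT
  -- Playing `x` for `τ*` rounds equals, in expectation, playing it with probability `τ* / T` in all
  -- `T` rounds.
  have h0 : (0 : ℝ) ≤ benchmarkTime T p B μ x / T := by positivity
  have h1 : (benchmarkTime T p B μ x / T : ℝ) ≤ 1 :=
    div_le_one_of_le₀ (Nat.cast_le.2 (benchmarkTime_le T p B μ x)) hT'.le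
  refine ⟨dilute i₀ x h0 h1, ?_, ?_⟩
  · rw [benchmarkReward_eq]
    simp only [meanGain, gain_dilute]
    rw [integral_const_mul]
    field_simp
  · have e : meanCost μ (dilute i₀ x h0 h1)
        = fun j => (1 / T : ℝ) * ((benchmarkTime T p B μ x : ℝ) * meanCost μ x j) := by
      ext j
      simp only [meanCost, cost_dilute, Pi.smul_apply, smul_eq_mul]
      rw [integral_const_mul]
      ring
    rw [e, lpNorm_smul hp (by positivity), one_div, inv_mul_le_iff₀ hT', mul_div_cancel₀ _ hT'.ne']
    exact lpNorm_benchmarkTime_le T μ hp hB x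

theorem benchmarkReward_nonneg (x : Simplex n) : 0 ≤ benchmarkReward T p B μ x := by
  rw [benchmarkReward_eq]
  exact mul_nonneg (Nat.cast_nonneg _) (meanGain_nonneg μ x)

theorem benchmarkReward_le (x : Simplex n) : benchmarkReward T p B μ x ≤ T := by
  rw [benchmarkReward_eq]
  have h : (benchmarkTime T p B μ x : ℝ) ≤ T := Nat.cast_le.2 (benchmarkTime_le T p B μ x)
  have := mul_le_mul h (meanGain_le_one μ x) (meanGain_nonneg μ x) (Nat.cast_nonneg T)
  rwa [mul_one] at this

theorem OPT_nonneg : 0 ≤ OPT T p B μ :=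
  Real.iSup_nonneg fun x => benchmarkReward_nonneg T μ x

theorem OPT_le : OPT T p B μ ≤ T :=
  have : Nonempty (Simplex n) := ⟨pureAction i₀⟩
  ciSup_le fun x => benchmarkReward_le T μ x

end Benchmark

/-! ### The reward of the algorithm -/

theorem HasRegretBound.nonneg {F : Feedback n k} {A : OnlineAlgorithm n (Fin k → ℝ)} {T : ℕ}
    {ρ : ℝ} (hρ : HasRegretBound F A T ρ) (i₀ : Fin n) : 0 ≤ ρ := by
  have h := hρ ⟨fun _ _ => 0, fun _ => measurable_const, fun _ _ _ => by simp⟩ (pureAction i₀)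
  simpa [adversaryReward] using h

section Reward

variable (F : Feedback n k) (A : OnlineAlgorithm n (Fin k → ℝ)) {c : Params}
  (hc : c.Admissible d) (μ : Measure (Round n d i₀)) [IsProbabilityMeasure μ]

theorem pairing_cost_nonneg (w : ℕ → Round n d i₀) (s : A.Seed) (t : ℕ) :
    0 ≤ pairing (c.rate, cost (w t) (surrogateAction F A c hc w s t))
      (gradPsi c.p c.r (c.delta d) (surrogateLoad F A c hc w s t)) :=
  hc.pairing_rate_nonneg (surrogateLoad_nonneg F A hc w s t).1
    (surrogateLoad_nonneg F A hc w s t).2 (cost_nonneg _ _)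

open Classical in
theorem sum_lagrangianReward_add_eq (s : A.Seed) (ω : Fin c.T → Round n d i₀) :
    ∑ t ∈ Finset.range c.T, lagrangianReward c (surrogateLoad F A c hc (dataAt ω) s t)
        (dataAt ω t) ⬝ᵥ (surrogateAction F A c hc (dataAt ω) s t : Fin n → ℝ)
      + c.lam * ∑ t ∈ Finset.range c.T,
        (if mixedNormTop c.p (surrogateLoad F A c hc (dataAt ω) s t) ≤ c.B then
          pairing (c.rate, cost (dataAt ω t) (surrogateAction F A c hc (dataAt ω) s t))
            (gradPsi c.p c.r (c.delta d) (surrogateLoad F A c hc (dataAt ω) s t)) else 0)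
      = totalReward F c.p c.B (lagrangianAlgorithm d F A c) s ω := by
  rw [totalReward_lagrangianAlgorithm F A hc, Finset.mul_sum, ← Finset.sum_add_distrib]
  refine Finset.sum_congr rfl fun t _ => ?_
  rw [lagrangianReward_dotProduct]
  split_ifs <;> ring

open Classical in
-- At time `T` the dummy load equals `B`, so there is a first `m ≤ T` at which the norm reaches `B`.
-- All rounds before `m` are open, and later terms are nonnegative.
theorem budget_le_sum_open (hBL : c.rate ≤ onesNorm d c.p) (w : ℕ → Round n d i₀) (s : A.Seed) :
    c.B * (1 - 2 * c.eps d) ≤ ∑ t ∈ Finset.range c.T,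
        (if mixedNormTop c.p (surrogateLoad F A c hc w s t) ≤ c.B then
          pairing (c.rate, cost (w t) (surrogateAction F A c hc w s t))
            (gradPsi c.p c.r (c.delta d) (surrogateLoad F A c hc w s t)) else 0) := by
  obtain ⟨m, hmT, hm, hopen⟩ : ∃ m ≤ c.T,
      c.B ≤ mixedNormTop c.p (surrogateLoad F A c hc w s m) ∧
        ∀ t < m, mixedNormTop c.p (surrogateLoad F A c hc w s t) ≤ c.B := by
    have hex : ∃ m, c.B ≤ mixedNormTop c.p (surrogateLoad F A c hc w s m) := by
      refine ⟨c.T, le_max_of_le_left ((le_of_eq ?_).trans (le_abs_self _))⟩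
      rw [surrogateLoad]
      exact hc.T_mul_rate.symm
    refine ⟨Nat.find hex, Nat.find_min' hex ?_, Nat.find_spec hex,
      fun t ht => (not_le.1 (Nat.find_min hex ht)).le⟩
    refine le_max_of_le_left ((le_of_eq ?_).trans (le_abs_self _))
    rw [surrogateLoad]
    exact hc.T_mul_rate.symm
  have e (t : ℕ) : surrogateLoad F A c hc w s t
      = pathLoad c.rate (fun i => cost (w i) (surrogateAction F A c hc w s i)) t := by
    rw [surrogateLoad]
  rw [e] at hm
  refine (budget_le_sum_pairing c hc.d_pos hc.one_le_p hc.one_le_r hc.B_pos hc.rate_pos.le hBL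
    (fun _ => cost_nonneg _ _) (fun _ => cost_le_one _ _) hm).trans ?_
  refine le_trans (Finset.sum_le_sum fun t ht => le_of_eq ?_)
    (Finset.sum_le_sum_of_subset_of_nonneg (Finset.range_mono hmT) fun t _ _ => ?_)
  · rw [if_pos (hopen t (Finset.mem_range.1 ht)), e]
  · split_ifs
    · exact pairing_cost_nonneg F A hc w s t
    · exact le_rfl

theorem openRounds_nonneg (w : ℕ → Round n d i₀) (s : A.Seed) : 0 ≤ openRounds F A hc w s :=
  Finset.sum_nonneg fun t _ => by split_ifs <;> simp

theorem openRounds_le (w : ℕ → Round n d i₀) (s : A.Seed) : openRounds F A hc w s ≤ c.T := by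
  refine (Finset.sum_le_sum (g := fun _ => (1 : ℝ)) fun t _ => ?_).trans (by simp)
  split_ifs <;> simp

include hc in
theorem OPT_mul_le_expectedReward {ρ : ℝ} (hρ : HasRegretBound F A c.T ρ)
    (hBL : c.rate ≤ onesNorm d c.p) (hopt : c.opt = OPT c.T c.p c.B μ) :
    c.opt * (1 - 2 * c.eps d - ((2 : ℝ) ^ (1 / c.r) - 1)) - c.scale d * ρ
      ≤ expectedReward c.T F c.p c.B (lagrangianAlgorithm d F A c) μ := by
  have hp0 : 0 < c.p := zero_lt_one.trans_le hc.one_le_p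
  have hr0 : 0 < c.r := zero_lt_one.trans_le hc.one_le_r
  have hT' : (0 : ℝ) < c.T := Nat.cast_pos.2 hc.T_pos
  have hlamB : c.lam * c.B = c.opt := div_mul_cancel₀ _ hc.B_pos.ne'
  have key (y : Simplex n) := comparator_add_le_expectedReward F A hc μ hρ y
    (κ := c.opt * (1 - 2 * c.eps d)) fun s ω => by
      rw [← sum_lagrangianReward_add_eq F A hc s ω, ← hlamB, mul_assoc]
      have := mul_le_mul_of_nonneg_left (budget_le_sum_open F A hc hBL (dataAt ω) s) hc.lam_nonneg
      linarith
  set N := ∫ q : A.Seed × (Fin c.T → Round n d i₀), openRounds F A hc (dataAt q.2) q.1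
        ∂(A.law.prod (Measure.pi fun _ => μ)) with hN
  have hN0 : 0 ≤ N := integral_nonneg fun q => openRounds_nonneg F A hc _ _
  have hN1 : N ≤ c.T := by
    have := integral_mono (integrable_openRounds F A hc μ) (integrable_const (c.T : ℝ)) fun q =>
      openRounds_le F A hc (dataAt q.2) q.1
    rwa [integral_const, probReal_univ, one_smul] at this
  set E := expectedReward c.T F c.p c.B (lagrangianAlgorithm d F A c) μ with hE
  have h2 : (1 : ℝ) ≤ 2 ^ (1 / c.r) := Real.one_le_rpow one_le_two (by positivity)
  -- The expected number `N` of open rounds does not depend on the comparator, so the factor `N / T`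
  -- survives the supremum.
  have main := mul_OPT_le (a := N / c.T) c.T μ (p := c.p) (B := c.B)
    (K := E - c.opt * (1 - 2 * c.eps d) + c.scale d * ρ + c.opt * 2 ^ (1 / c.r) * (N / c.T))
    (by positivity) fun x => by
      obtain ⟨y, hy1, hy2⟩ := exists_meanGain_eq c.T μ hc.T_pos hp0 hc.B_pos x
      have h3 := mixedNorm_le_two_rpow_mul (p := c.p) hr0 (v := (c.rate, meanCost μ y)) (b := c.rate)
        hc.rate_pos.le (abs_of_pos hc.rate_pos).le hy2
      have h4 := mul_le_mul_of_nonneg_right (mul_le_mul_of_nonneg_left h3 hc.lam_nonneg) hN0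
      have h5 : c.lam * (2 ^ (1 / c.r) * c.rate) * N = c.opt * 2 ^ (1 / c.r) * (N / c.T) := by
        rw [mul_left_comm, hc.lam_mul_rate]
        ring
      have h6 : N / c.T * benchmarkReward c.T c.p c.B μ x = meanGain μ y * N := by
        rw [← hy1]
        field_simp
      have h7 := key y
      rw [h6]
      linarith
  rw [← hopt] at main
  -- The comparator's reward and price nearly cancel; only this excess is left, and it is largest
  -- when all rounds are open.
  have h8 : c.opt * (2 ^ (1 / c.r) - 1) * (N / c.T) ≤ c.opt * (2 ^ (1 / c.r) - 1) * 1 :=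
    mul_le_mul_of_nonneg_left (div_le_one_of_le₀ hN1 hT'.le)
      (mul_nonneg hc.opt_nonneg (by linarith))
  linarith

include hc in
/-- If the budget cannot be exceeded, the learner is run on the rewards alone. -/
theorem OPT_sub_le_expectedReward {ρ : ℝ} (hρ : HasRegretBound F A c.T ρ)
    (hBL : c.T * onesNorm d c.p < c.B) (hopt : c.opt = 0) :
    OPT c.T c.p c.B μ - ρ
      ≤ expectedReward c.T F c.p c.B (lagrangianAlgorithm d F A c) μ := by
  have hp0 : 0 < c.p := zero_lt_one.trans_le hc.one_le_p
  have hlam : c.lam = 0 := by rw [Params.lam, hopt, zero_div]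
  have hscale : c.scale d = 1 := by rw [Params.scale, hlam, zero_mul, zero_add]
  -- Cost entries are at most one, so the load norm stays below `T L < B`.
  have hopen (w : ℕ → Round n d i₀) (s : A.Seed) : openRounds F A hc w s = c.T := by
    have h (t) (ht : t ∈ Finset.range c.T) :
        mixedNormTop c.p (surrogateLoad F A c hc w s t) ≤ c.B := by
      rw [mixedNormTop_surrogateLoad_le_iff F A hc w s (Finset.mem_range.1 ht).le]
      refine le_trans ?_ hBL.le
      refine lpNorm_le_mul_onesNorm hp0 (Nat.cast_nonneg _)
        (surrogateLoad_nonneg F A hc w s t).2 fun j => ?_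
      rw [surrogateLoad, pathLoad]
      dsimp only
      rw [Finset.sum_apply]
      calc _ ≤ ∑ i ∈ Finset.range t, (1 : ℝ) := Finset.sum_le_sum fun i _ => cost_le_one _ _ _
        _ ≤ c.T := by simpa using (Finset.mem_range.1 ht).le
    rw [openRounds, Finset.sum_congr rfl fun t ht => if_pos (h t ht)]
    simp
  have key (y : Simplex n) := comparator_add_le_expectedReward F A hc μ hρ y (κ := 0) fun s ω => by
      rw [← sum_lagrangianReward_add_eq F A hc s ω, hlam, zero_mul]
  have main := mul_OPT_le (a := 1) c.T μ (p := c.p) (B := c.B)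
    (K := expectedReward c.T F c.p c.B (lagrangianAlgorithm d F A c) μ + ρ) zero_le_one fun x => by
      obtain ⟨y, hy1, -⟩ := exists_meanGain_eq c.T μ hc.T_pos hp0 hc.B_pos x
      have h := key y
      simp only [hopen, hlam, hscale, integral_const, probReal_univ, one_smul] at h
      rw [← hy1]
      linarith
  linarith

end Reward

end

/-! ### The rates -/

theorem add_one_mul_le {V L B ρ : ℝ} (hB : 0 < B) (hρ : 0 ≤ ρ) (h : B ≤ V * L) :
    (V * L / B + 1) * ρ ≤ V * (2 * (L / B) * ρ) := by
  have h1 : 1 ≤ V * L / B := (one_le_div hB).2 h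
  have h2 : V * (2 * (L / B) * ρ) = 2 * (V * L / B) * ρ := by ring
  rw [h2]
  exact mul_le_mul_of_nonneg_right (by linarith) hρ

/-- With `z = (L / B)^(1/3)` the exponent is `r = 1 / z`, so `r L / B = z²`. Subadditivity of the
square root contributes `2 z`, and Bernoulli's `2 ^ z ≤ 1 + z` the third `z`. -/
theorem sqrt_add_rpow_le {p L B : ℝ} (hp : 0 ≤ p) (hL : 0 < L) (hLB : L ≤ B) :
    2 * √((p + max 1 ((B / L) ^ (1 / 3 : ℝ))) * L / B)
        + ((2 : ℝ) ^ (1 / max 1 ((B / L) ^ (1 / 3 : ℝ))) - 1)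
      ≤ 3 * (L / B) ^ (1 / 3 : ℝ) + 2 * (p * L / B) ^ (1 / 2 : ℝ) := by
  have hB : 0 < B := hL.trans_le hLB
  have hz : 0 < (L / B) ^ (1 / 3 : ℝ) := by positivity
  have hz1 : (L / B) ^ (1 / 3 : ℝ) ≤ 1 :=
    Real.rpow_le_one (by positivity) (div_le_one_of_le₀ hLB hB.le) (by norm_num)
  have hz3 : ((L / B) ^ (1 / 3 : ℝ)) ^ 3 = L / B := by
    rw [← Real.rpow_natCast, ← Real.rpow_mul (by positivity)]
    norm_num
  have hr : max 1 ((B / L) ^ (1 / 3 : ℝ)) = ((L / B) ^ (1 / 3 : ℝ))⁻¹ := by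
    rw [← Real.inv_rpow (by positivity), inv_div, max_eq_right]
    exact Real.one_le_rpow ((one_le_div hL).2 hLB) (by norm_num)
  rw [hr, one_div (_⁻¹), inv_inv, ← Real.sqrt_eq_rpow]
  set z := (L / B) ^ (1 / 3 : ℝ) with hz_def
  have e : (p + z⁻¹) * L / B = p * L / B + z ^ 2 := by
    have : (p + z⁻¹) * L / B = p * L / B + z⁻¹ * (L / B) := by ring
    rw [this, ← hz3]
    field_simp
  have h1 : √((p + z⁻¹) * L / B) ≤ √(p * L / B) + z := by
    rw [e]
    refine Real.sqrt_le_iff.2 ⟨by positivity, ?_⟩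
    have := Real.sq_sqrt (show 0 ≤ p * L / B by positivity)
    nlinarith [mul_nonneg (Real.sqrt_nonneg (p * L / B)) hz.le]
  have h2 := rpow_one_add_le_one_add_mul_self (s := 1) (p := z) (by norm_num) hz.le hz1
  norm_num at h2
  linarith

end BwK

end

theorem mainTheorem5
    (n d k T : ℕ) (hd : 0 < d) (hT : 0 < T) (i₀ : Fin n)
    (p B : ℝ) (hp : 1 ≤ p) (hB : 0 < B)
    (F : BwK.Feedback n k) (A : BwK.OnlineAlgorithm n (Fin k → ℝ))
    (ρ : ℝ) (hρ : BwK.HasRegretBound F A T ρ) :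
    (∀ r : ℝ, 1 ≤ r → B ≤ T * BwK.onesNorm d p →
      ∀ μ : MeasureTheory.Measure (BwK.Round n d i₀), MeasureTheory.IsProbabilityMeasure μ →
        (BwK.OPT T p B μ
              * (1 - 2 * √((p + r) * BwK.onesNorm d p / B) - ((2 : ℝ) ^ (1 / r) - 1))
            - (BwK.OPT T p B μ * BwK.onesNorm d p / B + 1) * ρ
          ≤ BwK.expectedReward T F p B
              (BwK.lagrangianAlgorithm d F A ⟨T, p, r, B, BwK.OPT T p B μ⟩) μ) ∧
        (B ≤ BwK.OPT T p B μ * BwK.onesNorm d p →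
          BwK.OPT T p B μ
              * (1 - 2 * √((p + r) * BwK.onesNorm d p / B) - ((2 : ℝ) ^ (1 / r) - 1)
                - 2 * (BwK.onesNorm d p / B) * ρ)
            ≤ BwK.expectedReward T F p B
                (BwK.lagrangianAlgorithm d F A ⟨T, p, r, B, BwK.OPT T p B μ⟩) μ)) ∧
    (∃ alg : ℝ → BwK.OnlineAlgorithm n (BwK.Obs n d k),
      (B ≤ T * BwK.onesNorm d p → ∀ V : ℝ, alg V = BwK.lagrangianAlgorithm d F A
        ⟨T, p, max 1 ((B / BwK.onesNorm d p) ^ (1 / 3 : ℝ)), B, V⟩) ∧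
      ∀ μ : MeasureTheory.Measure (BwK.Round n d i₀), MeasureTheory.IsProbabilityMeasure μ →
        (BwK.OPT T p B μ
            - BwK.OPT T p B μ * (3 * (BwK.onesNorm d p / B) ^ (1 / 3 : ℝ)
                + 2 * (p * BwK.onesNorm d p / B) ^ (1 / 2 : ℝ))
            - (BwK.OPT T p B μ * BwK.onesNorm d p / B + 1) * ρ
          ≤ BwK.expectedReward T F p B (alg (BwK.OPT T p B μ)) μ) ∧
        (B ≤ BwK.OPT T p B μ * BwK.onesNorm d p →
          BwK.OPT T p B μ
              - BwK.OPT T p B μ * (3 * (BwK.onesNorm d p / B) ^ (1 / 3 : ℝ)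
                  + 2 * (p * BwK.onesNorm d p / B) ^ (1 / 2 : ℝ)
                  + 2 * (BwK.onesNorm d p / B) * ρ)
            ≤ BwK.expectedReward T F p B (alg (BwK.OPT T p B μ)) μ)) := by
  have hp0 : 0 < p := zero_lt_one.trans_le hp
  have hL := BwK.onesNorm_pos hd hp0
  have hT' : (0 : ℝ) < T := Nat.cast_pos.2 hT
  have hρ0 := hρ.nonneg i₀
  have small (r : ℝ) (hr : 1 ≤ r) (hBL : B ≤ T * BwK.onesNorm d p)
      (μ : MeasureTheory.Measure (BwK.Round n d i₀)) (hμ : MeasureTheory.IsProbabilityMeasure μ) :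
      BwK.OPT T p B μ
            * (1 - 2 * √((p + r) * BwK.onesNorm d p / B) - ((2 : ℝ) ^ (1 / r) - 1))
          - (BwK.OPT T p B μ * BwK.onesNorm d p / B + 1) * ρ
        ≤ BwK.expectedReward T F p B
            (BwK.lagrangianAlgorithm d F A ⟨T, p, r, B, BwK.OPT T p B μ⟩) μ := by
    have hc : BwK.Params.Admissible ⟨T, p, r, B, BwK.OPT T p B μ⟩ d :=
      ⟨hd, hT, hp, hr, hB, BwK.OPT_nonneg T μ, BwK.OPT_le T μ⟩
    have h := BwK.OPT_mul_le_expectedReward F A hc μ hρ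
      ((div_le_iff₀' hT').2 hBL) rfl
    rwa [BwK.Params.scale, BwK.Params.lam, div_mul_eq_mul_div] at h
  refine ⟨fun r hr hBL μ hμ => ⟨small r hr hBL μ hμ, fun hV => ?_⟩, ?_⟩
  · have h1 := small r hr hBL μ hμ
    have h2 := BwK.add_one_mul_le hB hρ0 hV
    linarith
  suffices h : ∃ alg : ℝ → BwK.OnlineAlgorithm n (BwK.Obs n d k),
      (B ≤ T * BwK.onesNorm d p → ∀ V : ℝ, alg V = BwK.lagrangianAlgorithm d F A
        ⟨T, p, max 1 ((B / BwK.onesNorm d p) ^ (1 / 3 : ℝ)), B, V⟩) ∧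
      ∀ μ : MeasureTheory.Measure (BwK.Round n d i₀), MeasureTheory.IsProbabilityMeasure μ →
        BwK.OPT T p B μ
            - BwK.OPT T p B μ * (3 * (BwK.onesNorm d p / B) ^ (1 / 3 : ℝ)
                + 2 * (p * BwK.onesNorm d p / B) ^ (1 / 2 : ℝ))
            - (BwK.OPT T p B μ * BwK.onesNorm d p / B + 1) * ρ
          ≤ BwK.expectedReward T F p B (alg (BwK.OPT T p B μ)) μ by
    obtain ⟨alg, h1, h2⟩ := h
    refine ⟨alg, h1, fun μ hμ => ⟨h2 μ hμ, fun hV => ?_⟩⟩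
    have h3 := h2 μ hμ
    have h4 := BwK.add_one_mul_le hB hρ0 hV
    linarith
  rcases le_or_gt B (T * BwK.onesNorm d p) with hBL | hBL
  · refine ⟨_, fun _ V => rfl, fun μ hμ => ?_⟩
    have hV := BwK.OPT_nonneg T μ (p := p) (B := B)
    rcases le_or_gt (BwK.onesNorm d p) B with hLB | hLB
    · have h1 := small _ (le_max_left 1 ((B / BwK.onesNorm d p) ^ (1 / 3 : ℝ))) hBL μ hμ
      have h2 := mul_le_mul_of_nonneg_left (BwK.sqrt_add_rpow_le hp0.le hL hLB) hV
      linarith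
    -- For `B < L` the term `3 (L / B)^(1/3)` exceeds one, so the claimed bound is at most zero.
    · refine le_trans ?_ (BwK.expectedReward_nonneg F μ T p B _)
      have h1 : 1 ≤ (BwK.onesNorm d p / B) ^ (1 / 3 : ℝ) :=
        Real.one_le_rpow ((one_le_div hB).2 hLB.le) (by norm_num)
      have h2 : 0 ≤ (p * BwK.onesNorm d p / B) ^ (1 / 2 : ℝ) := by positivity
      have h3 : 0 ≤ (BwK.OPT T p B μ * BwK.onesNorm d p / B + 1) * ρ := by positivity
      have h4 := mul_le_mul_of_nonneg_left (show 1 ≤ 3 * (BwK.onesNorm d p / B) ^ (1 / 3 : ℝ)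
        + 2 * (p * BwK.onesNorm d p / B) ^ (1 / 2 : ℝ) by linarith) hV
      linarith
  -- The budget can never be exceeded here: the parameter `0` in place of `OPT` switches the prices
  -- off, and `r = 1` is an arbitrary admissible value.
  · refine ⟨fun _ => BwK.lagrangianAlgorithm d F A ⟨T, p, 1, B, 0⟩,
      fun h => absurd h hBL.not_ge, fun μ hμ => ?_⟩
    have hV := BwK.OPT_nonneg T μ (p := p) (B := B)
    have hc : BwK.Params.Admissible ⟨T, p, 1, B, 0⟩ d :=
      ⟨hd, hT, hp, le_rfl, hB, le_rfl, hT'.le⟩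
    have h1 := BwK.OPT_sub_le_expectedReward F A hc μ hρ hBL rfl
    have h2 : 0 ≤ BwK.OPT T p B μ * (3 * (BwK.onesNorm d p / B) ^ (1 / 3 : ℝ)
        + 2 * (p * BwK.onesNorm d p / B) ^ (1 / 2 : ℝ)) := by positivity
    have h3 : 0 ≤ BwK.OPT T p B μ * BwK.onesNorm d p / B * ρ := by positivity
    dsimp only at h1
    linarith
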